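/- Let $n\ge 2$ agents communicate over a strongly connected, weight-balanced digraph with weights $a_{ij}\ge 0$ ($a_{ij}>0$ iff $(i,j)$ is an edge), Laplacian $L=\mathrm{diag}\big(\sum_j a_{ij}\big)-[a_{ij}]$, and let $\eta_2(\hat L)$ be the second smallest eigenvalue of $\hat L=(L+L^{\top})/2$. For $i=1,\dots,n$ let $\mathcal X_i\subseteq\mathbb R^{d_i}$ be closed and convex, $f_i:\mathbb R^{d_i}\to\mathbb R$, $A_i\in\mathbb R^{p\times d_i}$ and $b_i\in\mathbb R^p$, and put $b=\sum_{i=1}^n b_i$, $\mathcal X=\prod_{i=1}^n\mathcal X_i$. Assume that $f_i$ is differentiable with locally Lipschitz gradient on an open set containing $\mathcal X_i$, that $f_i$ is $\mu_i$-strongly convex on $\mathcal X_i$ with $\mu_i>0$, and that some $\mathbf x$ in the relative interior of $\mathcal X$ satisfies $\sum_{i=1}^n A_ix_i=b$ (Slater's condition). Let $\mu=\min_i\mu_i$, let $\bar\sigma(\mathbf A)$ be the largest singular value of $\mathbf A=\mathrm{diag}\{A_1,\dots,A_n\}$, and let $\varphi>0$, $\alpha>0$ and $\beta$ satisfy $$\alpha\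 \ge\ \frac{(\varphi^2+3\varphi+3)\,\bar\sigma^2(\mathbf A)}{(\varphi+1)\mu},\qquad \beta\ \ge\ \frac{(\varphi+1)^2\alpha}{\varphi\,\eta_2(\hat L)}.$$ Then the problem $$\min_{\mathbf x=(x_1,\dots,x_n)}\ \sum_{i=1}^n f_i(x_i)\quad\text{s.t.}\quad \sum_{i=1}^n A_ix_i=b,\quad x_i\in\mathcal X_i\ (i=1,\dots,n)$$ has a unique optimal solution $\mathbf x^*$, and for all initial values $w_i(0)\in\mathbb R^{d_i}$, $\lambda_i(0)\in\mathbb R^p$, $z_i(0)\in\mathbb R^p$ with $\sum_{i=1}^n z_i(0)=0$ the dynamics (Proj-IDEA) $$\begin{aligned}\dot w_i&=-\alpha\big(w_i-x_i+\nabla f_i(x_i)+A_i^{\top}\lambda_i\big)-A_i^{\top}m_i,\\ \dot\lambda_i&=m_i-\beta\sum_{j=1}^n a_{ij}(\lambda_i-\lambda_j),\\ \dot z_i&=\alpha\beta\sum_{j=1}^n a_{ij}(\lambda_i-\lambda_j),\\ x_i&=P_{\mathcal X_i}(w_i),\qquad m_i=A_ix_i-b_i-z_i,\end{aligned}$$ where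 $P_{\mathcal X_i}$ is the Euclidean projection onto $\mathcal X_i$, has a solution on $[0,\infty)$, and along every such solution $\mathbf x(t)=(x_1(t),\dots,x_n(t))$ converges to $\mathbf x^*$ as $t\to\infty$. -/

import Mathlib

open Set Filter Topology

noncomputable section

/-- A weighted digraph on the agents `0, …, n - 1`: `weight i j > 0` iff `(i, j)` is an edge
(agent `i` receives information from agent `j`), and `weight i j = 0` otherwise. Self-loops may be
present or not; the Laplacian does not depend on them. -/
structure WeightedDigraph (n : ℕ) where
  weight : Matrix (Fin n) (Fin n) ℝ
  weight_nonneg : ∀ i j, 0 ≤ weight i j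

namespace WeightedDigraph

variable {n : ℕ} (G : WeightedDigraph n)

/-- `(i, j)` is an edge. -/
def Edge (i j : Fin n) : Prop := 0 < G.weight i j

/-- Any agent is joined to any other one by a directed path. -/
def StronglyConnected : Prop := ∀ i j, Relation.ReflTransGen G.Edge i j

/-- `d_i^in = ∑_j a_{ji}`. -/
def inDegree (i : Fin n) : ℝ := ∑ j, G.weight j i

/-- `d_i^out = ∑_j a_{ij}`. -/
def outDegree (i : Fin n) : ℝ := ∑ j, G.weight i j

def WeightBalanced : Prop := ∀ i, G.inDegree i = G.outDegree i

/-- The Laplacian `L = D^out - 𝒜`. -/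
def laplacian : Matrix (Fin n) (Fin n) ℝ := Matrix.diagonal G.outDegree - G.weight

/-- The symmetrized Laplacian `(L + Lᵀ) / 2`. -/
def symmLaplacian : Matrix (Fin n) (Fin n) ℝ :=
  (1 / 2 : ℝ) • (G.laplacian + G.laplacian.transpose)

theorem symmLaplacian_isHermitian : G.symmLaplacian.IsHermitian := by
  unfold Matrix.IsHermitian symmLaplacian
  rw [Matrix.conjTranspose_eq_transpose_of_trivial, Matrix.transpose_smul, Matrix.transpose_add,
    Matrix.transpose_transpose, add_comm]

end WeightedDigraph

/-- The second smallest eigenvalue, counted with multiplicity, of a real symmetric matrix of size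
at least 2 (`eigenvalues₀` lists the eigenvalues in decreasing order). -/
def secondSmallestEigenvalue {n : ℕ} (hn : 2 ≤ n) {M : Matrix (Fin n) (Fin n) ℝ}
    (hM : M.IsHermitian) : ℝ :=
  hM.eigenvalues₀ ⟨n - 2, by rw [Fintype.card_fin]; omega⟩

/-- The largest singular value of a real matrix. -/
def largestSingularValue {m k : Type*} [Fintype m] [Fintype k] [DecidableEq k]
    (M : Matrix m k ℝ) : ℝ :=
  (Matrix.toEuclideanLin M).singularValues 0

/-- `x` is the Euclidean projection of `y` onto `X`: `x ∈ X` minimizes `‖y - u‖` over `u ∈ X`. -/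
def IsProjection {E : Type*} [NormedAddCommGroup E] (X : Set E) (y x : E) : Prop :=
  x ∈ X ∧ IsMinOn (fun u => ‖y - u‖) X x

/-- The stacked vectors `[x_1, …, x_n]` with `x_i ∈ ℝ^{d i}`. -/
abbrev Stacked {n : ℕ} (d : Fin n → ℕ) : Type := ∀ i : Fin n, EuclideanSpace ℝ (Fin (d i))

/-- The feasible set of the problem: `∑ A_i x_i = b` and `x_i ∈ X_i` for all `i`. -/
def feasibleSet {n p : ℕ} {d : Fin n → ℕ} (X : ∀ i, Set (EuclideanSpace ℝ (Fin (d i))))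
    (A : ∀ i, Matrix (Fin p) (Fin (d i)) ℝ) (b : EuclideanSpace ℝ (Fin p)) : Set (Stacked d) :=
  {x | ∑ i, Matrix.toEuclideanLin (A i) (x i) = b ∧ x ∈ univ.pi X}

/-- `x` is an optimal solution of: minimize `∑ f_i(x_i)` over the feasible set. -/
def IsOptimalSolution {n p : ℕ} {d : Fin n → ℕ} (f : ∀ i, EuclideanSpace ℝ (Fin (d i)) → ℝ)
    (X : ∀ i, Set (EuclideanSpace ℝ (Fin (d i)))) (A : ∀ i, Matrix (Fin p) (Fin (d i)) ℝ)
    (b : EuclideanSpace ℝ (Fin p)) (x : Stacked d) : Prop :=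
  x ∈ feasibleSet X A b ∧ IsMinOn (fun y => ∑ i, f i (y i)) (feasibleSet X A b) x

/-- `(w, l, z, x)` is a trajectory on `[0, ∞)` of the dynamics Proj-IDEA (agent by agent), where
`l` stands for the multipliers `λ_i` and `b i` are the summands of the right-hand side of the
coupled constraint:
`w_i' = -α (w_i - x_i + ∇f_i(x_i) + A_iᵀ λ_i) - A_iᵀ m_i`,
`λ_i' = m_i - β ∑_j a_ij (λ_i - λ_j)`,
`z_i' = α β ∑_j a_ij (λ_i - λ_j)`,
`x_i = P_{X_i}(w_i)`, `m_i = A_i x_i - b_i - z_i`. -/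
structure IsProjIDEATrajectory {n p : ℕ} {d : Fin n → ℕ} (G : WeightedDigraph n)
    (f : ∀ i, EuclideanSpace ℝ (Fin (d i)) → ℝ) (X : ∀ i, Set (EuclideanSpace ℝ (Fin (d i))))
    (A : ∀ i, Matrix (Fin p) (Fin (d i)) ℝ) (b : Fin n → EuclideanSpace ℝ (Fin p)) (α β : ℝ)
    (w : ℝ → Stacked d) (l z : ℝ → Fin n → EuclideanSpace ℝ (Fin p)) (x : ℝ → Stacked d) :
    Prop where
  proj : ∀ t, 0 ≤ t → ∀ i, IsProjection (X i) (w t i) (x t i)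
  deriv_w : ∀ t, 0 ≤ t → ∀ i, HasDerivWithinAt (fun s => w s i)
    (-(α • (w t i - x t i + gradient (f i) (x t i) + Matrix.toEuclideanLin (A i).transpose (l t i)))
      - Matrix.toEuclideanLin (A i).transpose
          (Matrix.toEuclideanLin (A i) (x t i) - b i - z t i)) (Ici 0) t
  deriv_l : ∀ t, 0 ≤ t → ∀ i, HasDerivWithinAt (fun s => l s i)
    ((Matrix.toEuclideanLin (A i) (x t i) - b i - z t i)
      - β • ∑ j, G.weight i j • (l t i - l t j)) (Ici 0) t
  deriv_z : ∀ t, 0 ≤ t → ∀ i, HasDerivWithinAt (fun s => z s i)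
    ((α * β) • ∑ j, G.weight i j • (l t i - l t j)) (Ici 0) t

end

/-! Strong convexity gives existence and uniqueness of the optimum `x*`, and the relative-interior
Slater condition gives a multiplier `λ*` for the coupled constraint. Repeating `λ*` at every agent
produces a consensual primal-dual point. Convergence is measured against this point, with `ζ = z -
(A x* - b)`. Weight balance conserves the sum of the `z_i`, so `ζ` always has zero sum.

The Lyapunov function is `(‖w - x*‖² - ‖w - P w‖²) / 2` plus a quadratic form in `(λ - λ*, ζ)`. The
first term is differentiable although `P` need not be: the squared distance has gradient `2 (w - P
w)`, so the two terms together differentiate to `⟨P w - x*, w'⟩`. The form is positive definite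
because its cross coefficient is `1 / (φ + 1) < 1`. Along the flow (`Admissible.lyapunovDeriv_le`)
`ζ` meets `λ - λ*` only through the disagreement part of the latter. The gain `β` and the spectral
gap absorb that part, and `α` and strong convexity absorb `A (x - x*)`. What remains is `V' ≤ -(α μ
/ 2) ‖x - x*‖²`.

Thus `x = P w`, `λ` and `z` stay bounded. `V` does not control `w`, but `w' + α w` is bounded, hence
so is `w`. This a priori bound gives global existence by truncating the vector field
(`Admissible.exists_isSolutionOn`). It also makes `‖x - x*‖²` Lipschitz in time, and a Barbalat
argument gives convergence (`Admissible.tendsto`). The network enters only through the hypotheses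
checked in `admissible_projIDEAFlow`. -/

open Set Filter Topology

noncomputable section

/-! ### Projections onto convex sets. -/

section Projection

variable {E : Type*} [NormedAddCommGroup E] [InnerProductSpace ℝ E]

/-- `P` satisfies the variational inequality that characterizes the projection onto `X`. -/
def IsProjectionMap (X : Set E) (P : E → E) : Prop :=
  ∀ w, P w ∈ X ∧ ∀ u ∈ X, inner ℝ (w - P w) (u - P w) ≤ 0

theorem isProjection_iff_inner_le_zero {X : Set E} (hX : Convex ℝ X) {y x : E} :
    IsProjection X y x ↔ x ∈ X ∧ ∀ u ∈ X, inner ℝ (y - x) (u - x) ≤ 0 := by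
  refine and_congr_right fun hx => ?_
  rw [← norm_eq_iInf_iff_real_inner_le_zero hX hx]
  have : Nonempty X := ⟨⟨x, hx⟩⟩
  have hb : BddBelow (range fun w : X => ‖y - w‖) := ⟨0, by rintro _ ⟨w, rfl⟩; exact norm_nonneg _⟩
  constructor
  · intro h
    exact le_antisymm (le_ciInf fun w => h w.2) (ciInf_le hb ⟨x, hx⟩)
  · intro h u hu
    change ‖y - x‖ ≤ ‖y - u‖
    rw [h]
    exact ciInf_le hb ⟨u, hu⟩

theorem exists_isProjectionMap [CompleteSpace E] {X : Set E} (hne : X.Nonempty) (hc : IsClosed X)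
    (hX : Convex ℝ X) : ∃ P : E → E, IsProjectionMap X P := by
  choose P hP hP' using exists_norm_eq_iInf_of_complete_convex hne hc.isComplete hX
  exact ⟨P, fun w => ⟨hP w, (norm_eq_iInf_iff_real_inner_le_zero hX (hP w)).1 (hP' w)⟩⟩

namespace IsProjectionMap

variable {X : Set E} {P : E → E}

theorem inner_sub_le_zero (hP : IsProjectionMap X P) (w v : E) :
    inner ℝ (w - P w) (P v - P w) ≤ 0 := (hP w).2 _ (hP v).1

theorem eq_of_inner_le_zero (hP : IsProjectionMap X P) {w x : E} (hx : x ∈ X)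
    (h : ∀ u ∈ X, inner ℝ (w - x) (u - x) ≤ 0) : P w = x := by
  have h1 := (hP w).2 x hx
  have h2 := h _ (hP w).1
  have h3 : inner ℝ (P w - x) (P w - x) ≤ 0 := by
    have : inner ℝ (P w - x) (P w - x)
        = inner ℝ (w - P w) (x - P w) + inner ℝ (w - x) (P w - x) := by
      simp only [inner_sub_left, inner_sub_right]; ring
    linarith
  rw [real_inner_self_eq_norm_sq] at h3
  exact sub_eq_zero.1 (norm_eq_zero.1 (pow_eq_zero_iff two_ne_zero |>.1
    (le_antisymm h3 (by positivity))))

theorem norm_sub_sq_le (hP : IsProjectionMap X P) (w v : E) :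
    ‖P w - P v‖ ^ 2 ≤ inner ℝ (w - v) (P w - P v) := by
  have h1 := hP.inner_sub_le_zero w v
  have h2 := hP.inner_sub_le_zero v w
  rw [← real_inner_self_eq_norm_sq]
  simp only [inner_sub_left, inner_sub_right] at *
  rw [real_inner_comm (P w) (P v)] at *
  linarith

theorem norm_sub_le (hP : IsProjectionMap X P) (w v : E) : ‖P w - P v‖ ≤ ‖w - v‖ := by
  have h1 := hP.norm_sub_sq_le w v
  have h2 := real_inner_le_norm (w - v) (P w - P v)
  by_contra! h
  nlinarith [norm_nonneg (w - v), norm_nonneg (P w - P v)]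

theorem lipschitzWith (hP : IsProjectionMap X P) : LipschitzWith 1 P :=
  LipschitzWith.of_dist_le_mul fun w v => by
    simpa [dist_eq_norm] using hP.norm_sub_le w v

/-- The error of the linearization is quadratic, so the squared distance is differentiable without
any smoothness of `P`. The bounds combine the variational inequalities at `w` and `v` with
nonnegative squares. -/
theorem abs_dist_sq_sub_le (hP : IsProjectionMap X P) (w v : E) :
    |‖v - P v‖ ^ 2 - ‖w - P w‖ ^ 2 - 2 * inner ℝ (w - P w) (v - w)| ≤ ‖v - w‖ ^ 2 := by
  have h1 := hP.inner_sub_le_zero w v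
  have h2 := hP.inner_sub_le_zero v w
  have h3 := hP.norm_sub_sq_le w v
  have h4 : 0 ≤ ‖(v - P v) - (w - P w)‖ ^ 2 := by positivity
  have h5 : 0 ≤ ‖(v - w) - (P v - P w)‖ ^ 2 := by positivity
  have h6 : 0 ≤ ‖P w - P v‖ ^ 2 := by positivity
  simp only [← real_inner_self_eq_norm_sq] at *
  simp only [inner_sub_left, inner_sub_right] at *
  rw [real_inner_comm (P v) (P w), real_inner_comm v w, real_inner_comm (P v) v,
    real_inner_comm (P w) w, real_inner_comm (P w) v, real_inner_comm (P v) w] at *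
  rw [abs_le]
  constructor <;> linarith

theorem hasDerivWithinAt_dist_sq (hP : IsProjectionMap X P) {w : ℝ → E} {w' : E} {s : Set ℝ}
    {t : ℝ} (hw : HasDerivWithinAt w w' s t) :
    HasDerivWithinAt (fun r => ‖w r - P (w r)‖ ^ 2) (2 * inner ℝ (w t - P (w t)) w') s t := by
  have hF : HasFDerivAt (fun v => ‖v - P v‖ ^ 2)
      ((2 : ℝ) • innerSL ℝ (w t - P (w t))) (w t) := by
    rw [hasFDerivAt_iff_isLittleO]
    refine (Asymptotics.IsBigO.of_bound 1 (Eventually.of_forall fun v => ?_)).trans_isLittleO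
      (g := fun v => ‖v - w t‖ ^ 2) ?_
    · have := hP.abs_dist_sq_sub_le (w t) v
      simpa [inner_sub_left] using this
    · have h : (fun v => ‖v - w t‖ ^ 2) =o[𝓝 (w t)] fun v => ‖v - w t‖ ^ 1 := by
        refine (Asymptotics.isLittleO_pow_pow (m := 1) (n := 2) (by norm_num)).comp_tendsto
          (k := fun v => ‖v - w t‖) ?_
        have : Continuous fun v => ‖v - w t‖ := by fun_prop
        simpa using this.tendsto (w t)
      simpa using h
  have := hF.comp_hasDerivWithinAt t hw
  simpa [Function.comp_def, inner_sub_left] using this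

end IsProjectionMap

end Projection

/-! ### First-order consequences of strong convexity. -/

section FirstOrder

variable {E : Type*} [NormedAddCommGroup E] [InnerProductSpace ℝ E] [CompleteSpace E]

/-- Divide the strong convexity inequality on the segment from `x` to `y` by `t` and let `t → 0+`;
the modulus term carries a factor `1 - t` that tends to 1. -/
theorem StrongConvexOn.add_inner_gradient_le {X : Set E} {m : ℝ} {f : E → ℝ}
    (hf : StrongConvexOn X m f) {x y : E} (hx : x ∈ X) (hy : y ∈ X)
    (hd : DifferentiableAt ℝ f x) :
    f x + inner ℝ (gradient f x) (y - x) + m / 2 * ‖y - x‖ ^ 2 ≤ f y := by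
  have hg := hd.hasGradientAt.hasFDerivAt
  have hl : HasDerivAt (fun t : ℝ => x + t • (y - x)) (y - x) 0 := by
    simpa using ((hasDerivAt_id (0 : ℝ)).smul_const (y - x)).const_add x
  have hc : HasDerivAt (fun t : ℝ => f (x + t • (y - x))) (inner ℝ (gradient f x) (y - x)) 0 := by
    have := HasFDerivAt.comp_hasDerivAt (f := fun t : ℝ => x + t • (y - x)) (0 : ℝ)
      (by simpa using hg) hl
    simpa [Function.comp_def] using this
  have ht := (hasDerivAt_iff_tendsto_slope_zero.1 hc).mono_left
    (nhdsWithin_mono 0 (fun t (ht : 0 < t) => ht.ne') : 𝓝[>] (0 : ℝ) ≤ 𝓝[≠] 0)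
  have hr : Tendsto (fun t : ℝ => f y - f x - (1 - t) * (m / 2 * ‖y - x‖ ^ 2)) (𝓝[>] 0)
      (𝓝 (f y - f x - (1 - 0) * (m / 2 * ‖y - x‖ ^ 2))) := by
    refine Tendsto.mono_left ?_ nhdsWithin_le_nhds
    exact Continuous.tendsto (by fun_prop) 0
  have hle := le_of_tendsto_of_tendsto ht hr (by
    filter_upwards [Ioc_mem_nhdsGT (zero_lt_one' ℝ)] with t ht
    have h := hf.2 hx hy (sub_nonneg.2 ht.2) ht.1.le (by ring)
    have he : (1 - t) • x + t • y = x + t • (y - x) := by module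
    rw [he] at h
    simp only [smul_eq_mul, zero_add, zero_smul, add_zero] at h ⊢
    rw [norm_sub_rev x y] at h
    rw [inv_mul_le_iff₀ ht.1]
    nlinarith)
  linarith

theorem StrongConvexOn.mul_norm_sub_sq_le_inner_gradient {X : Set E} {m : ℝ} {f : E → ℝ}
    (hf : StrongConvexOn X m f) {x y : E} (hx : x ∈ X) (hy : y ∈ X)
    (hdx : DifferentiableAt ℝ f x) (hdy : DifferentiableAt ℝ f y) :
    m * ‖x - y‖ ^ 2 ≤ inner ℝ (gradient f x - gradient f y) (x - y) := by
  have h1 := hf.add_inner_gradient_le hx hy hdx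
  have h2 := hf.add_inner_gradient_le hy hx hdy
  rw [norm_sub_rev y x] at h1
  have : inner ℝ (gradient f x - gradient f y) (x - y)
      = - inner ℝ (gradient f x) (y - x) - inner ℝ (gradient f y) (x - y) := by
    rw [← neg_sub x y, inner_neg_right, inner_sub_left]; ring
  linarith

end FirstOrder

/-! ### Lagrange multipliers from Slater's condition. -/

section Multiplier

variable {E F : Type*} [NormedAddCommGroup E] [NormedSpace ℝ E] [AddCommGroup F] [Module ℝ F]

theorem exists_add_smul_mem_of_mem_intrinsicInterior {X : Set E} {x v : E}
    (hx : x ∈ intrinsicInterior ℝ X) (hv : v ∈ (affineSpan ℝ X).direction) :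
    ∃ ε : ℝ, 0 < ε ∧ x + ε • v ∈ X := by
  obtain ⟨y, hy, rfl⟩ := mem_intrinsicInterior.1 hx
  let γ : ℝ → affineSpan ℝ X := fun ε => ⟨ε • v + y.1,
    AffineSubspace.vadd_mem_of_mem_direction (Submodule.smul_mem _ ε hv) y.2⟩
  have hγ : Continuous γ := by
    refine Continuous.subtype_mk ?_ _
    fun_prop
  have h0 : γ 0 = y := by ext; simp [γ]
  have hmem : ∀ᶠ ε in 𝓝 (0 : ℝ), γ ε ∈ ((↑) ⁻¹' X : Set (affineSpan ℝ X)) := by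
    refine hγ.continuousAt.eventually ?_
    rw [h0]
    exact mem_interior_iff_mem_nhds.1 hy
  obtain ⟨ε, h1, h2⟩ := ((hmem.filter_mono nhdsWithin_le_nhds).and
    (self_mem_nhdsWithin : Ioi (0 : ℝ) ∈ 𝓝[>] 0)).exists
  exact ⟨ε, h2, by simpa [γ, add_comm] using h1⟩

/-- Existence of a Lagrange multiplier under the relative-interior Slater condition, for a linear
objective that is minimized at `x` over `X ∩ {y | T y = T x}`. -/
theorem exists_multiplier_of_mem_intrinsicInterior {X : Set E} (hX : Convex ℝ X) (g : E →ₗ[ℝ] ℝ)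
    (T : E →ₗ[ℝ] F) {x x₀ : E} (hx : x ∈ X) (hx₀ : x₀ ∈ intrinsicInterior ℝ X) (hT : T x₀ = T x)
    (hmin : ∀ y ∈ X, T y = T x → 0 ≤ g (y - x)) :
    ∃ ℓ : F →ₗ[ℝ] ℝ, ∀ y ∈ X, 0 ≤ g (y - x) + ℓ (T (y - x)) := by
  -- Work in the direction space of `X`, where a relative interior point is interior.
  let V := (affineSpan ℝ X).direction
  have hV : ∀ {y z}, y ∈ X → z ∈ X → y - z ∈ V := fun hy hz =>
    AffineSubspace.vsub_mem_direction (mem_affineSpan ℝ hy) (mem_affineSpan ℝ hz)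
  have hx₀X : x₀ ∈ X := intrinsicInterior_subset hx₀
  let C : PointedCone ℝ V :=
    { carrier := {v | ∃ c : ℝ, 0 ≤ c ∧ ∃ y ∈ X, (v : E) = c • (y - x)}
      add_mem' := by
        rintro a b ⟨c, hc, y, hy, h1⟩ ⟨e, he, z, hz, h2⟩
        rcases (add_nonneg hc he).eq_or_lt with h | h
        · have hc0 : c = 0 := by linarith
          have he0 : e = 0 := by linarith
          exact ⟨0, le_rfl, x, hx, by simp [h1, h2, hc0, he0]⟩
        · refine ⟨c + e, h.le, (c / (c + e)) • y + (e / (c + e)) • z,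
            hX hy hz (by positivity) (by positivity) (by field_simp), ?_⟩
          have h3 : (c + e) • ((c / (c + e)) • y + (e / (c + e)) • z) = c • y + e • z := by
            rw [smul_add, smul_smul, smul_smul, mul_div_cancel₀ _ h.ne', mul_div_cancel₀ _ h.ne']
          rw [Submodule.coe_add, h1, h2, smul_sub (c + e), h3]
          module
      zero_mem' := ⟨0, le_rfl, x, hx, by simp⟩
      smul_mem' := by
        rintro r a ⟨c, hc, y, hy, h1⟩
        exact ⟨r * c, mul_nonneg r.2 hc, y, hy, by
          change (r : ℝ) • (a : E) = _
          rw [h1, smul_smul]⟩ }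
  let TV : V →ₗ[ℝ] F := T ∘ₗ V.subtype
  let gV : V →ₗ[ℝ] ℝ := g ∘ₗ V.subtype
  let f : V →ₗ.[ℝ] ℝ := ⟨LinearMap.ker TV, gV ∘ₗ (LinearMap.ker TV).subtype⟩
  -- M. Riesz extension: on `ker TV` the objective is nonnegative on the cone `C` of feasible
  -- directions, by minimality; extend it to `h`, nonnegative on all of `C`.
  obtain ⟨h, hf, hC⟩ := riesz_extension C f
    (by
      rintro ⟨v, hv⟩ ⟨c, hc, y, hy, h1⟩
      change 0 ≤ g (v : E)
      rcases hc.eq_or_lt with rfl | hc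
      · rw [h1]; simp
      · have h2 : T (v : E) = 0 := hv
        rw [h1, map_smul, smul_eq_zero_iff_right hc.ne', map_sub, sub_eq_zero] at h2
        rw [h1, map_smul]
        exact mul_nonneg hc.le (hmin y hy h2))
    (by
      -- Slater's point enters here: since `x₀ + ε v ∈ X`, adding the kernel vector `ε⁻¹ (x₀ - x)`
      -- moves `v` into `C`.
      intro v
      obtain ⟨ε, hε, hm⟩ := exists_add_smul_mem_of_mem_intrinsicInterior hx₀ v.2
      refine ⟨⟨ε⁻¹ • ⟨x₀ - x, hV hx₀X hx⟩, ?_⟩, ε⁻¹, by positivity, _, hm, ?_⟩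
      · change TV _ = 0
        rw [map_smul]
        change ε⁻¹ • T (x₀ - x) = 0
        rw [map_sub, hT, sub_self, smul_zero]
      · change ε⁻¹ • (x₀ - x) + (v : E) = _
        rw [add_sub_right_comm, smul_add, smul_smul, inv_mul_cancel₀ hε.ne', one_smul])
  -- As `h` and `gV` agree on `ker TV`, their difference factors through `TV`; the factor is the
  -- multiplier.
  have hker : LinearMap.ker TV ≤ LinearMap.ker (h - gV) := by
    intro v hv
    have := hf ⟨v, hv⟩
    change h v = gV v at this
    simp [this]
  obtain ⟨ℓ, hℓ⟩ := LinearMap.exists_extend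
    ((LinearMap.ker TV).liftQ (h - gV) hker ∘ₗ TV.quotKerEquivRange.symm.toLinearMap)
  refine ⟨ℓ, fun y hy => ?_⟩
  let v : V := ⟨y - x, hV hy hx⟩
  have h1 : 0 ≤ h v := hC v ⟨1, zero_le_one, y, hy, by simp [v]⟩
  have h2 : ℓ (T (y - x)) = h v - gV v := by
    have := LinearMap.congr_fun hℓ ⟨TV v, LinearMap.mem_range_self TV v⟩
    simp only [LinearMap.comp_apply, Submodule.subtype_apply, LinearEquiv.coe_coe] at this
    change ℓ (TV v) = _
    rw [this]
    have hq : TV.quotKerEquivRange.symm ⟨TV v, LinearMap.mem_range_self TV v⟩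
        = (LinearMap.ker TV).mkQ v := by
      rw [LinearEquiv.symm_apply_eq]; rfl
    rw [hq]; rfl
  rw [h2]
  change 0 ≤ gV v + (h v - gV v)
  linarith

end Multiplier

/-! ### Global solutions of ordinary differential equations. -/

section GlobalODE

open scoped NNReal

variable {Y : Type*} [NormedAddCommGroup Y] [NormedSpace ℝ Y]

/-- A bounded Lipschitz vector field has global integral curves. -/
theorem exists_hasDerivAt_of_lipschitzWith_of_bounded [CompleteSpace Y] {v : Y → Y} {K M : ℝ≥0}
    (hv : LipschitzWith K v) (hM : ∀ y, ‖v y‖ ≤ M) (y₀ : Y) :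
    ∃ u : ℝ → Y, u 0 = y₀ ∧ ∀ t, HasDerivAt u (v (u t)) t := by
  have hloc : ∀ N : ℕ, ∃ u : ℝ → Y, u 0 = y₀ ∧
      ∀ t ∈ Ioo (-(N + 1 : ℝ)) (N + 1), HasDerivAt u (v (u t)) t := by
    intro N
    have h0 : (0 : ℝ) ∈ Icc (-(N + 1 : ℝ)) (N + 1) := by
      constructor <;> linarith [N.cast_nonneg (α := ℝ)]
    -- A speed bound `M` over time `N + 1` keeps the curve in the ball of radius `M (N + 1)`, so one
    -- Picard–Lindelöf step covers the whole interval.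
    have hp : IsPicardLindelof (fun _ => v) (⟨0, h0⟩ : Icc (-(N + 1 : ℝ)) (N + 1)) y₀
        (M * (N + 1)) 0 M K :=
      { lipschitzOnWith := fun _ _ => hv.lipschitzOnWith
        continuousOn := fun _ _ => continuousOn_const
        norm_le := fun _ _ x _ => hM x
        mul_max_le := by simp }
    obtain ⟨u, hu0, hu⟩ := hp.exists_eq_forall_mem_Icc_hasDerivWithinAt₀
    exact ⟨u, hu0, fun t ht => (hu t (Ioo_subset_Icc_self ht)).hasDerivAt (Icc_mem_nhds ht.1 ht.2)⟩
  choose U hU0 hU using hloc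
  have hEq : ∀ {N N' : ℕ}, N ≤ N' → EqOn (U N) (U N') (Ioo (-(N + 1 : ℝ)) (N + 1)) := by
    intro N N' h
    have h' : (N : ℝ) ≤ N' := by exact_mod_cast h
    refine ODE_solution_unique_of_mem_Ioo (v := fun _ => v) (s := fun _ => univ) (K := K) (t₀ := 0)
      (fun _ _ => hv.lipschitzOnWith) ⟨by linarith [N.cast_nonneg (α := ℝ)], by positivity⟩
      (fun t ht => ⟨hU N t ht, mem_univ _⟩)
      (fun t ht => ⟨hU N' t ⟨by linarith [ht.1], by linarith [ht.2]⟩, mem_univ _⟩) ?_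
    rw [hU0, hU0]
  have hmem : ∀ {t : ℝ} {N : ℕ}, |t| ≤ N → t ∈ Ioo (-(N + 1 : ℝ)) (N + 1) := fun h => by
    rw [abs_le] at h
    constructor <;> linarith
  refine ⟨fun t => U ⌈|t|⌉₊ t, by simp [hU0], fun t => ?_⟩
  have ht := hmem (Nat.le_ceil |t|)
  obtain ⟨N, hN⟩ := exists_nat_gt |t|
  have key : ∀ s : ℝ, |s| < N → U ⌈|s|⌉₊ s = U N s := fun s hs =>
    hEq (Nat.ceil_le.2 hs.le) (hmem (Nat.le_ceil |s|))
  have hd := hU N t (hmem hN.le)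
  rw [← key t hN] at hd
  refine hd.congr_of_eventuallyEq ?_
  filter_upwards [(isOpen_lt continuous_abs continuous_const).mem_nhds hN] with s hs
  exact key s hs

/-- Truncation: if the vector field `v` agrees on the ball of radius `R` with a bounded Lipschitz
one and solutions of `y' = v y` stay in the interior of this ball, then there is a global one. -/
theorem exists_hasDerivWithinAt_of_truncation [CompleteSpace Y] {v v' : Y → Y} {K M : ℝ≥0} {R : ℝ}
    (hv : LipschitzWith K v') (hM : ∀ y, ‖v' y‖ ≤ M) (heq : ∀ y, ‖y‖ ≤ R → v' y = v y) (y₀ : Y)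
    (hR : ∀ (T : ℝ) (u : ℝ → Y), 0 ≤ T → u 0 = y₀ →
      (∀ t ∈ Icc 0 T, HasDerivWithinAt u (v (u t)) (Ici 0) t) → ‖u T‖ < R) :
    ∃ u : ℝ → Y, u 0 = y₀ ∧ ∀ t, 0 ≤ t → HasDerivWithinAt u (v (u t)) (Ici 0) t := by
  obtain ⟨u, hu0, hu⟩ := exists_hasDerivAt_of_lipschitzWith_of_bounded hv hM y₀
  have hcont : Continuous u := continuous_iff_continuousAt.2 fun t => (hu t).continuousAt
  have hlt : ∀ t, 0 ≤ t → ‖u t‖ < R := by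
    by_contra! h
    let S : Set ℝ := {t | 0 ≤ t ∧ R ≤ ‖u t‖}
    have hS : IsClosed S := (isClosed_le continuous_const continuous_id).inter
      (isClosed_le continuous_const hcont.norm)
    have hb : BddBelow S := ⟨0, fun t ht => ht.1⟩
    obtain ⟨h0, h1⟩ := hS.csInf_mem h hb
    have hbefore : ∀ t, 0 ≤ t → t < sInf S → ‖u t‖ < R := fun t ht0 ht => by
      by_contra! h2
      exact (csInf_le hb ⟨ht0, h2⟩).not_gt ht
    have hle : ∀ t ∈ Icc 0 (sInf S), ‖u t‖ ≤ R := by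
      rcases h0.eq_or_lt with h2 | h2
      -- Exit at time 0: `u` cannot be used in `hR`, since the fields are only known to agree on the
      -- ball. Any curve with velocity `v (u 0)` at time 0 will do, so take a straight line.
      · have hlt0 : ‖u 0‖ < R := hR 0 (fun t => u 0 + t • v (u 0)) le_rfl (by simpa using hu0) (by
          intro t ht
          obtain rfl : t = 0 := le_antisymm ht.2 ht.1
          simpa using (((hasDerivAt_id (0 : ℝ)).smul_const (v (u 0))).const_add
            (u 0)).hasDerivWithinAt) |>.trans_eq' (by simp)
        rw [← h2] at h1
        exact absurd h1 hlt0.not_ge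
      · intro t ht
        have : Icc 0 (sInf S) ⊆ {t | ‖u t‖ ≤ R} := by
          rw [← closure_Ico h2.ne]
          exact closure_minimal (fun t ht => (hbefore t ht.1 ht.2).le)
            (isClosed_le hcont.norm continuous_const)
        exact this ht
    refine (hR _ u h0 hu0 fun t ht => ?_).not_ge h1
    rw [← heq _ (hle t ht)]
    exact (hu t).hasDerivWithinAt
  refine ⟨u, hu0, fun t ht => ?_⟩
  rw [← heq _ (hlt t ht).le]
  exact (hu t).hasDerivWithinAt

end GlobalODE

/-! ### A Barbalat-type lemma. -/

section Barbalat

/-- If `V` is bounded below on `[0, ∞)`, `V' ≤ -ε h` and `h ≥ 0` is Lipschitz, then `h → 0`. -/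
theorem tendsto_zero_of_deriv_le_neg {V V' h : ℝ → ℝ} {ε K C : ℝ} (hε : 0 < ε)
    (hV : ∀ t, 0 ≤ t → HasDerivWithinAt V (V' t) (Ici 0) t)
    (hV' : ∀ t, 0 ≤ t → V' t ≤ -(ε * h t)) (hh : ∀ t, 0 ≤ t → 0 ≤ h t)
    (hbdd : ∀ t, 0 ≤ t → C ≤ V t)
    (hK : ∀ s t, 0 ≤ s → s ≤ t → h s - h t ≤ K * (t - s)) : Tendsto h atTop (𝓝 0) := by
  have hcont : ContinuousOn V (Ici 0) := fun t ht => (hV t ht).continuousWithinAt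
  have hderiv : ∀ t, 0 < t → HasDerivAt V (V' t) t := fun t ht =>
    (hV t ht.le).hasDerivAt (Ici_mem_nhds ht)
  have hanti : AntitoneOn V (Ici 0) := by
    refine antitoneOn_of_deriv_nonpos (convex_Ici 0) hcont ?_ ?_ <;> rw [interior_Ici]
    · exact fun t ht => (hderiv t ht).differentiableAt.differentiableWithinAt
    · intro t ht
      rw [(hderiv t ht).deriv]
      have := mul_nonneg hε.le (hh t (le_of_lt ht))
      linarith [hV' t (le_of_lt ht)]
  have hlim : ∃ l, Tendsto (fun t => V (max t 0)) atTop (𝓝 l) := by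
    refine ⟨_, tendsto_atTop_ciInf (fun s t hst => hanti (mem_Ici.2 (le_max_right s 0))
      (mem_Ici.2 (le_max_right t 0)) (max_le_max_right 0 hst)) ⟨C, ?_⟩⟩
    rintro _ ⟨t, rfl⟩
    exact hbdd _ (le_max_right _ _)
  obtain ⟨l, hl⟩ := hlim
  have hl : Tendsto V atTop (𝓝 l) := hl.congr' (by
    filter_upwards [eventually_ge_atTop 0] with t ht
    rw [max_eq_left ht])
  -- The mean value theorem bounds `h` at some `c ∈ (t, t + δ)` by the drop of `V`; the Lipschitz
  -- bound carries this back to `t`. For fixed `δ` the drop tends to 0.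
  have hstep : ∀ t δ, 0 ≤ t → 0 < δ → h t ≤ (V t - V (t + δ)) / (ε * δ) + |K| * δ := by
    intro t δ ht hδ
    obtain ⟨c, hc, hcV⟩ := exists_hasDerivAt_eq_slope V V' (by linarith : t < t + δ)
      (hcont.mono fun s hs => le_trans ht hs.1)
      (fun s hs => hderiv s (lt_of_le_of_lt ht hs.1))
    have h1 := hV' c (ht.trans hc.1.le)
    rw [hcV, add_sub_cancel_left, div_le_iff₀ hδ] at h1
    have h2 := hK t c ht hc.1.le
    have h3 : K * (c - t) ≤ |K| * δ := mul_le_mul (le_abs_self K) (by linarith [hc.2])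
      (by linarith [hc.1]) (abs_nonneg K)
    have h4 : h c ≤ (V t - V (t + δ)) / (ε * δ) := by
      rw [le_div_iff₀ (by positivity)]
      nlinarith
    linarith
  rw [Metric.tendsto_atTop]
  intro r hr
  let δ := r / (2 * (|K| + 1))
  have hδ : 0 < δ := by positivity
  have hKδ : |K| * δ < r / 2 := by
    have : (|K| + 1) * δ = r / 2 := by simp only [δ]; field_simp
    linarith
  have hdiff : Tendsto (fun t => (V t - V (t + δ)) / (ε * δ)) atTop (𝓝 0) := by
    have := (hl.sub (hl.comp (tendsto_atTop_add_const_right _ δ tendsto_id))).div_const (ε * δ)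
    simpa using this
  obtain ⟨N, hN⟩ := (Metric.tendsto_atTop.1 hdiff) (r / 2) (by positivity)
  refine ⟨max N 0, fun t ht => ?_⟩
  have h0 : 0 ≤ t := (le_max_right _ _).trans ht
  have h1 := hN t ((le_max_left _ _).trans ht)
  rw [Real.dist_eq, sub_zero] at h1 ⊢
  rw [abs_of_nonneg (hh t h0)]
  linarith [hstep t δ h0 hδ, le_abs_self ((V t - V (t + δ)) / (ε * δ))]

end Barbalat

/-! ### The abstract flow: Lyapunov function, a priori bounds, convergence. -/

/-- The data of a projected primal-dual flow: the constraint set `X` with projection `P`, the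
gradient `g`, the constraint map `A` with adjoint `B`, the Laplacian `L`, the right-hand side `b`
and the gains `α`, `β`. -/
structure ProjFlow (E H : Type*) [NormedAddCommGroup E] [InnerProductSpace ℝ E]
    [NormedAddCommGroup H] [InnerProductSpace ℝ H] where
  X : Set E
  P : E → E
  g : E → E
  A : E →L[ℝ] H
  B : H →L[ℝ] E
  L : H →L[ℝ] H
  b : H
  α : ℝ
  β : ℝ

namespace ProjFlow

variable {E H F : Type*} [NormedAddCommGroup E] [InnerProductSpace ℝ E]
  [NormedAddCommGroup H] [InnerProductSpace ℝ H] [NormedAddCommGroup F] [NormedSpace ℝ F]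
  (D : ProjFlow E H)

/-- The residual `A x - b - z` at `x = P w`. -/
def residual (w : E) (z : H) : H := D.A (D.P w) - D.b - z

def velW (w : E) (l z : H) : E :=
  -(D.α • (w - D.P w + D.g (D.P w) + D.B l)) - D.B (D.residual w z)

def velL (w : E) (l z : H) : H := D.residual w z - D.β • D.L l

def velZ (l : H) : H := (D.α * D.β) • D.L l

/-- `(w, l, z)` solves the flow equations at all times in `s`. -/
structure IsSolutionOn (s : Set ℝ) (w : ℝ → E) (l z : ℝ → H) : Prop where
  deriv_w : ∀ t ∈ s, HasDerivWithinAt w (D.velW (w t) (l t) (z t)) (Ici 0) t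
  deriv_l : ∀ t ∈ s, HasDerivWithinAt l (D.velL (w t) (l t) (z t)) (Ici 0) t
  deriv_z : ∀ t ∈ s, HasDerivWithinAt z (D.velZ (l t)) (Ici 0) t

/-- The standing assumptions: strong monotonicity (`μ`) and local Lipschitz continuity of `g` on
`X`, the bound `σ` on `A`, and the spectral gap `η` of `L` relative to the kernel of `S`. -/
structure Admissible (S : H →L[ℝ] F) (μ σ η φ : ℝ) : Prop where
  isClosed : IsClosed D.X
  isProjectionMap : IsProjectionMap D.X D.P
  locallyLipschitzOn : LocallyLipschitzOn D.X D.g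
  monotone : ∀ x ∈ D.X, ∀ y ∈ D.X, μ * ‖x - y‖ ^ 2 ≤ inner ℝ (D.g x - D.g y) (x - y)
  adjoint : ∀ x y, inner ℝ (D.A x) y = inner ℝ x (D.B y)
  norm_le : ∀ x, ‖D.A x‖ ≤ σ * ‖x‖
  map_L : ∀ l, S (D.L l) = 0
  gap : ∀ l, ∃ q : H, (∀ z, S z = 0 → inner ℝ l z = inner ℝ q z) ∧
    η * ‖q‖ ^ 2 ≤ inner ℝ l (D.L l)
  φ_pos : 0 < φ
  α_pos : 0 < D.α
  μ_pos : 0 < μ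
  η_pos : 0 < η
  le_α : (φ ^ 2 + 3 * φ + 3) * σ ^ 2 ≤ D.α * ((φ + 1) * μ)
  le_β : (φ + 1) ^ 2 * D.α ≤ D.β * (φ * η)

/-- `(x, l)` is a primal-dual solution. -/
structure IsEquilibrium (S : H →L[ℝ] F) (x : E) (l : H) : Prop where
  mem : x ∈ D.X
  map_l : D.L l = 0
  map_residual : S (D.A x - D.b) = 0
  variational : ∀ y ∈ D.X, 0 ≤ inner ℝ (D.g x + D.B l) (y - x)

/-- The Lyapunov function with respect to the equilibrium `(x, l)`. -/
def lyapunov (φ : ℝ) (x : E) (l : H) (w : E) (l' z : H) : ℝ :=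
  (‖w - x‖ ^ 2 - ‖w - D.P w‖ ^ 2) / 2 + D.α / 2 * ‖l' - l‖ ^ 2
    + (φ + 1)⁻¹ * inner ℝ (l' - l) (z - (D.A x - D.b))
    + (φ + 1)⁻¹ / (2 * D.α) * ‖z - (D.A x - D.b)‖ ^ 2

/-- The derivative of the Lyapunov function along the flow. -/
def lyapunovDeriv (φ : ℝ) (x : E) (l : H) (w : E) (l' z : H) : ℝ :=
  inner ℝ (D.P w - x) (D.velW w l' z) + D.α * inner ℝ (l' - l) (D.velL w l' z)
    + (φ + 1)⁻¹ * (inner ℝ (l' - l) (D.velZ l')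
      + inner ℝ (D.velL w l' z) (z - (D.A x - D.b)))
    + (φ + 1)⁻¹ / D.α * inner ℝ (z - (D.A x - D.b)) (D.velZ l')

variable {D} {S : H →L[ℝ] F} {μ σ η φ : ℝ} {x : E} {l : H}

theorem Admissible.hasDerivWithinAt_lyapunov (hD : D.Admissible S μ σ η φ) {w : ℝ → E}
    {l' z : ℝ → H} {s : Set ℝ} (h : D.IsSolutionOn s w l' z) {t : ℝ} (ht : t ∈ s) :
    HasDerivWithinAt (fun r => D.lyapunov φ x l (w r) (l' r) (z r))
      (D.lyapunovDeriv φ x l (w t) (l' t) (z t)) (Ici 0) t := by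
  have hw := h.deriv_w t ht
  have hl := (h.deriv_l t ht).sub_const l
  have hz := (h.deriv_z t ht).sub_const (D.A x - D.b)
  have h1 := ((hw.sub_const x).norm_sq.sub
    (hD.isProjectionMap.hasDerivWithinAt_dist_sq hw)).div_const 2
  have h2 := hl.norm_sq.const_mul (D.α / 2)
  have h3 := (hl.inner ℝ hz).const_mul (φ + 1)⁻¹
  have h4 := hz.norm_sq.const_mul ((φ + 1)⁻¹ / (2 * D.α))
  refine (((h1.add h2).add h3).add h4).congr_deriv ?_
  have hα := hD.α_pos.ne'
  have h5 : inner ℝ (D.P (w t) - x) (D.velW (w t) (l' t) (z t))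
      = inner ℝ (w t - x) (D.velW (w t) (l' t) (z t))
        - inner ℝ (w t - D.P (w t)) (D.velW (w t) (l' t) (z t)) := by
    simp only [inner_sub_left]; ring
  simp only [lyapunovDeriv, h5]
  field_simp

/-- The coupling `α ⟨a, ℓ⟩` cancels between the `w` and `l` equations, and `⟨ζ, L ℓ⟩` between the
cross term and the `z` equation. The surviving mixed products `⟨a, ζ⟩` and `⟨q, ζ⟩` are handled by
completing squares. -/
theorem Admissible.lyapunovDeriv_le (hD : D.Admissible S μ σ η φ) (he : D.IsEquilibrium S x l)
    (w : E) (l' : H) {z : H} (hz : S z = 0) :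
    D.lyapunovDeriv φ x l w l' z ≤ -(D.α * μ / 2 * ‖D.P w - x‖ ^ 2) := by
  have hα := hD.α_pos
  have hφ := hD.φ_pos
  set u := D.P w with hu
  set ζ := z - (D.A x - D.b) with hζ
  set ℓ := l' - l with hℓ
  set a := D.A (u - x) with ha
  obtain ⟨q, hq, hgap⟩ := hD.gap ℓ
  have hm : D.residual w z = a - ζ := by
    simp only [residual, hζ, ha, map_sub, ← hu]; abel
  have hLl : D.L l' = D.L ℓ := by rw [hℓ, map_sub, he.map_l, sub_zero]
  have hζS : S ζ = 0 := by rw [hζ, map_sub, hz, he.map_residual, sub_zero]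
  have huX : u ∈ D.X := (hD.isProjectionMap w).1
  have e1 : 0 ≤ inner ℝ (u - x) (w - u) := by
    have := (hD.isProjectionMap w).2 x he.mem
    rw [real_inner_comm, ← neg_sub x u, inner_neg_right]
    exact neg_nonneg.2 this
  have e2 := he.variational u huX
  have e3 := hD.monotone u huX x he.mem
  have e4 : inner ℝ (u - x) (D.velW w l' z)
      = -(D.α * (inner ℝ (u - x) (w - u) + inner ℝ (u - x) (D.g u) + inner ℝ a l'))
        - (inner ℝ a a - inner ℝ a ζ) := by
    have hB : ∀ y, inner ℝ (u - x) (D.B y) = inner ℝ a y := fun y => (hD.adjoint _ y).symm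
    rw [velW, hm, ← hu, inner_sub_right, inner_neg_right, inner_smul_right, inner_add_right,
      inner_add_right, hB, hB, inner_sub_right a a ζ]
  have e5 : μ * ‖u - x‖ ^ 2 + inner ℝ a ℓ ≤ inner ℝ (u - x) (D.g u) + inner ℝ a l' := by
    rw [inner_add_left, real_inner_comm _ (D.B l), ← hD.adjoint, ← ha] at e2
    rw [inner_sub_left] at e3
    rw [hℓ, inner_sub_right, real_inner_comm (D.g u)]
    linarith
  have e6 : inner ℝ ℓ (D.velL w l' z)
      = inner ℝ a ℓ - inner ℝ q ζ - D.β * inner ℝ ℓ (D.L ℓ) := by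
    rw [velL, hm, hLl, inner_sub_right, inner_sub_right, inner_smul_right, hq ζ hζS,
      real_inner_comm]
  have e7 : inner ℝ (D.velL w l' z) ζ
      = inner ℝ a ζ - ‖ζ‖ ^ 2 - D.β * inner ℝ ζ (D.L ℓ) := by
    rw [velL, hm, hLl, inner_sub_left, inner_sub_left, inner_smul_left, real_inner_self_eq_norm_sq,
      real_inner_comm ζ (D.L ℓ)]
    simp
  have e8 : ∀ y, inner ℝ y (D.velZ l') = D.α * D.β * inner ℝ y (D.L ℓ) := fun y => by
    rw [velZ, hLl, inner_smul_right]
  have e9 : ‖a‖ ^ 2 ≤ σ ^ 2 * ‖u - x‖ ^ 2 := by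
    rw [← mul_pow]
    exact pow_le_pow_left₀ (norm_nonneg _) (hD.norm_le _) 2
  -- After multiplication by `φ + 1` the available term is `-‖ζ‖²`. It is split as `1/4` for `⟨q,
  -- ζ⟩` (`s1` over 4) and `3/4` for `⟨a, ζ⟩` (`s2` over 12).
  have s1 : 0 ≤ 4 * (φ + 1) ^ 2 * D.α ^ 2 * ‖q‖ ^ 2 + 4 * (φ + 1) * D.α * inner ℝ q ζ
      + ‖ζ‖ ^ 2 := by
    have : 0 ≤ ‖(2 * (φ + 1) * D.α) • q + ζ‖ ^ 2 := by positivity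
    rw [norm_add_sq_real, norm_smul, inner_smul_left, mul_pow, Real.norm_eq_abs, sq_abs] at this
    simp only [conj_trivial] at this
    linarith
  have s2 : 0 ≤ 9 * ‖ζ‖ ^ 2 - 12 * (φ + 2) * inner ℝ a ζ + 4 * (φ + 2) ^ 2 * ‖a‖ ^ 2 := by
    have : 0 ≤ ‖(2 * (φ + 2)) • a - (3 : ℝ) • ζ‖ ^ 2 := by positivity
    rw [norm_sub_sq_real, norm_smul, norm_smul, inner_smul_left, inner_smul_right, mul_pow, mul_pow,
      Real.norm_eq_abs, sq_abs, Real.norm_eq_abs, sq_abs] at this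
    simp only [conj_trivial] at this
    linarith
  -- The lower bound on `β` is exactly what lets the Laplacian term pay for the `‖q‖²` from `s1`.
  have s3 : D.α ^ 2 * (φ + 1) ^ 2 * ‖q‖ ^ 2 ≤ D.α * D.β * φ * inner ℝ ℓ (D.L ℓ) := by
    have hβ : 0 ≤ D.β := by
      have h1 : 0 < D.β * (φ * η) := lt_of_lt_of_le (by positivity) hD.le_β
      exact (pos_of_mul_pos_left h1 (mul_pos hφ hD.η_pos).le).le
    calc D.α ^ 2 * (φ + 1) ^ 2 * ‖q‖ ^ 2
        = D.α * ((φ + 1) ^ 2 * D.α) * ‖q‖ ^ 2 := by ring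
      _ ≤ D.α * (D.β * (φ * η)) * ‖q‖ ^ 2 :=
          mul_le_mul_of_nonneg_right (mul_le_mul_of_nonneg_left hD.le_β hα.le) (sq_nonneg _)
      _ = D.α * D.β * φ * (η * ‖q‖ ^ 2) := by ring
      _ ≤ _ := by gcongr
  -- The leftover coefficient of `‖a‖²` is `(φ + 2)² / 3 - (φ + 1) = (φ² + φ + 1) / 3`. So a third
  -- of the strong convexity term suffices, and more than half of it remains.
  have s4 : (φ ^ 2 + φ + 1) * ‖a‖ ^ 2 ≤ D.α * ((φ + 1) * μ) * ‖u - x‖ ^ 2 := by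
    calc (φ ^ 2 + φ + 1) * ‖a‖ ^ 2 ≤ (φ ^ 2 + 3 * φ + 3) * (σ ^ 2 * ‖u - x‖ ^ 2) := by
          gcongr <;> linarith
      _ = (φ ^ 2 + 3 * φ + 3) * σ ^ 2 * ‖u - x‖ ^ 2 := by ring
      _ ≤ _ := mul_le_mul_of_nonneg_right hD.le_α (sq_nonneg _)
  have hk : (0 : ℝ) < φ + 1 := by positivity
  have hμ := hD.μ_pos
  have hX2 : 0 ≤ D.α * ((φ + 1) * μ) * ‖u - x‖ ^ 2 := by positivity
  have e10 : D.α * (μ * ‖u - x‖ ^ 2 + inner ℝ a ℓ)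
      ≤ D.α * (inner ℝ (u - x) (w - u) + inner ℝ (u - x) (D.g u) + inner ℝ a l') :=
    mul_le_mul_of_nonneg_left (by linarith) hα.le
  have hle : D.lyapunovDeriv φ x l w l' z ≤ -(D.α * μ * ‖u - x‖ ^ 2) - ‖a‖ ^ 2 + inner ℝ a ζ
      - D.α * inner ℝ q ζ - D.α * D.β * inner ℝ ℓ (D.L ℓ)
      + (φ + 1)⁻¹ * (inner ℝ a ζ - ‖ζ‖ ^ 2 + D.α * D.β * inner ℝ ℓ (D.L ℓ)) := by
    rw [lyapunovDeriv, ← hu, ← hζ, ← hℓ, e4, e6, e7, e8, e8, real_inner_self_eq_norm_sq]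
    have : (φ + 1)⁻¹ / D.α * (D.α * D.β * inner ℝ ζ (D.L ℓ))
        = (φ + 1)⁻¹ * (D.β * inner ℝ ζ (D.L ℓ)) := by field_simp
    rw [this]
    nlinarith
  refine hle.trans ?_
  rw [← mul_le_mul_iff_right₀ hk]
  have hc : (φ + 1) * ((φ + 1)⁻¹ * (inner ℝ a ζ - ‖ζ‖ ^ 2 + D.α * D.β * inner ℝ ℓ (D.L ℓ)))
      = inner ℝ a ζ - ‖ζ‖ ^ 2 + D.α * D.β * inner ℝ ℓ (D.L ℓ) := by field_simp
  rw [mul_add, hc]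
  nlinarith

/-- The projection inequality handles the `w` part. The form in `(ℓ, ζ)` is completed to a square in
two ways, leaving either `‖ℓ‖²` or `‖ζ‖²` with a positive coefficient. -/
theorem Admissible.norm_sq_le_lyapunov (hD : D.Admissible S μ σ η φ) (he : x ∈ D.X)
    (w : E) (l' z : H) :
    ‖D.P w - x‖ ^ 2 / 2 ≤ D.lyapunov φ x l w l' z ∧
    φ * D.α / (2 * (φ + 1)) * ‖l' - l‖ ^ 2 ≤ D.lyapunov φ x l w l' z ∧
    φ / (2 * D.α * (φ + 1) ^ 2) * ‖z - (D.A x - D.b)‖ ^ 2 ≤ D.lyapunov φ x l w l' z := by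
  have hα := hD.α_pos
  have hφ := hD.φ_pos
  set ζ := z - (D.A x - D.b) with hζ
  set ℓ := l' - l with hℓ
  have h1 : ‖D.P w - x‖ ^ 2 / 2 ≤ (‖w - x‖ ^ 2 - ‖w - D.P w‖ ^ 2) / 2 := by
    have h2 := (hD.isProjectionMap w).2 x he
    have h3 : w - x = (w - D.P w) - (x - D.P w) := by abel
    rw [h3, norm_sub_sq_real (w - D.P w), norm_sub_rev (D.P w) x]
    linarith
  have hx : 0 ≤ ‖D.P w - x‖ ^ 2 / 2 := by positivity
  have h4 : D.α / 2 * ‖ℓ‖ ^ 2 + (φ + 1)⁻¹ * inner ℝ ℓ ζ + (φ + 1)⁻¹ / (2 * D.α) * ‖ζ‖ ^ 2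
      = φ * D.α / (2 * (φ + 1)) * ‖ℓ‖ ^ 2 + 1 / (2 * D.α * (φ + 1)) * ‖D.α • ℓ + ζ‖ ^ 2 := by
    rw [norm_add_sq_real, norm_smul, inner_smul_left, mul_pow, Real.norm_eq_abs, sq_abs]
    simp only [conj_trivial]
    field_simp
    ring
  have h5 : D.α / 2 * ‖ℓ‖ ^ 2 + (φ + 1)⁻¹ * inner ℝ ℓ ζ + (φ + 1)⁻¹ / (2 * D.α) * ‖ζ‖ ^ 2
      = φ / (2 * D.α * (φ + 1) ^ 2) * ‖ζ‖ ^ 2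
        + 1 / (2 * D.α * (φ + 1) ^ 2) * ‖((φ + 1) * D.α) • ℓ + ζ‖ ^ 2 := by
    rw [norm_add_sq_real, norm_smul, inner_smul_left, mul_pow, Real.norm_eq_abs, sq_abs]
    simp only [conj_trivial]
    field_simp
    ring
  have h6 : 0 ≤ φ * D.α / (2 * (φ + 1)) * ‖ℓ‖ ^ 2 := by positivity
  have h7 : 0 ≤ 1 / (2 * D.α * (φ + 1)) * ‖D.α • ℓ + ζ‖ ^ 2 := by positivity
  have h8 : 0 ≤ 1 / (2 * D.α * (φ + 1) ^ 2) * ‖((φ + 1) * D.α) • ℓ + ζ‖ ^ 2 := by positivity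
  rw [lyapunov, ← hζ, ← hℓ]
  refine ⟨?_, ?_, ?_⟩ <;> linarith

/-- On a sublevel set of the Lyapunov function everything but `w` is bounded. -/
theorem Admissible.exists_bound_of_lyapunov_le (hD : D.Admissible S μ σ η φ) (he : x ∈ D.X)
    (C : ℝ) : ∃ R, 0 ≤ R ∧ ∀ (w : E) (l' z : H), D.lyapunov φ x l w l' z ≤ C →
      ‖D.P w‖ ≤ R ∧ ‖l'‖ ≤ R ∧ ‖z‖ ≤ R := by
  have hα := hD.α_pos
  have hφ := hD.φ_pos
  set k₁ := φ * D.α / (2 * (φ + 1)) with hk₁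
  set k₂ := φ / (2 * D.α * (φ + 1) ^ 2) with hk₂
  have h1 : 0 < k₁ := by positivity
  have h2 : 0 < k₂ := by positivity
  have hb : ∀ (y y₀ : H) (r : ℝ), ‖y - y₀‖ ^ 2 ≤ r → ‖y‖ ≤ ‖y₀‖ + √r := fun y y₀ r h => by
    have := Real.le_sqrt_of_sq_le h
    linarith [norm_le_norm_add_norm_sub y₀ y, norm_sub_rev y y₀]
  have hb' : ∀ (y y₀ : E) (r : ℝ), ‖y - y₀‖ ^ 2 ≤ r → ‖y‖ ≤ ‖y₀‖ + √r := fun y y₀ r h => by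
    have := Real.le_sqrt_of_sq_le h
    linarith [norm_le_norm_add_norm_sub y₀ y, norm_sub_rev y y₀]
  refine ⟨(‖x‖ + √(2 * C)) + (‖l‖ + √(C / k₁)) + (‖D.A x - D.b‖ + √(C / k₂)), by positivity,
    fun w l' z h => ?_⟩
  obtain ⟨e1, e2, e3⟩ := hD.norm_sq_le_lyapunov (l := l) he w l' z
  have p1 : 0 ≤ ‖x‖ + √(2 * C) := by positivity
  have p2 : 0 ≤ ‖l‖ + √(C / k₁) := by positivity
  have p3 : 0 ≤ ‖D.A x - D.b‖ + √(C / k₂) := by positivity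
  refine ⟨?_, ?_, ?_⟩
  · linarith [hb' (D.P w) x (2 * C) (by linarith)]
  · linarith [hb l' l (C / k₁) ((le_div_iff₀' h1).2 (e2.trans h))]
  · linarith [hb z (D.A x - D.b) (C / k₂) ((le_div_iff₀' h2).2 (e3.trans h))]

theorem Admissible.exists_bound_gradient [ProperSpace E] (hD : D.Admissible S μ σ η φ) (R : ℝ) :
    ∃ M, ∀ w, ‖D.P w‖ ≤ R → ‖D.g (D.P w)‖ ≤ M := by
  have hc : IsCompact (Metric.closedBall (0 : E) R ∩ D.X) :=
    (isCompact_closedBall 0 R).inter_right hD.isClosed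
  obtain ⟨M, hM⟩ := hc.exists_bound_of_continuousOn
    (hD.locallyLipschitzOn.continuousOn.mono inter_subset_right)
  exact ⟨M, fun w hw => hM _ ⟨by simpa using hw, (hD.isProjectionMap w).1⟩⟩

/-- On a sublevel set of the Lyapunov function, `w' + α w` is bounded. -/
theorem Admissible.exists_bound_velW [ProperSpace E] (hD : D.Admissible S μ σ η φ) (he : x ∈ D.X)
    (C : ℝ) : ∃ K, 0 ≤ K ∧ ∀ (w : E) (l' z : H), D.lyapunov φ x l w l' z ≤ C →
      ‖D.velW w l' z + D.α • w‖ ≤ K := by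
  obtain ⟨R, hR, hb⟩ := hD.exists_bound_of_lyapunov_le (l := l) he C
  obtain ⟨M, hM⟩ := hD.exists_bound_gradient R
  have hM0 : 0 ≤ |M| := abs_nonneg M
  refine ⟨D.α * (R + |M| + ‖D.B‖ * R) + ‖D.B‖ * (‖D.A‖ * R + ‖D.b‖ + R), ?_, fun w l' z h => ?_⟩
  · have := hD.α_pos
    positivity
  obtain ⟨h1, h2, h3⟩ := hb w l' z h
  have hα := hD.α_pos
  have e : D.velW w l' z + D.α • w
      = D.α • (D.P w - D.g (D.P w) - D.B l') - D.B (D.residual w z) := by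
    rw [velW]; module
  have e1 : ‖D.P w - D.g (D.P w) - D.B l'‖ ≤ R + |M| + ‖D.B‖ * R := by
    refine (norm_sub_le _ _).trans (add_le_add ((norm_sub_le _ _).trans
      (add_le_add h1 ((hM w h1).trans (le_abs_self M)))) ?_)
    exact (D.B.le_opNorm _).trans (by gcongr)
  have e2 : ‖D.residual w z‖ ≤ ‖D.A‖ * R + ‖D.b‖ + R := by
    refine (norm_sub_le _ _).trans (add_le_add ((norm_sub_le _ _).trans
      (add_le_add ?_ le_rfl)) h3)
    exact (D.A.le_opNorm _).trans (by gcongr)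
  rw [e]
  refine (norm_sub_le _ _).trans (add_le_add ?_ ?_)
  · rw [norm_smul, Real.norm_of_nonneg hα.le]
    gcongr
  · exact (D.B.le_opNorm _).trans (by gcongr)

/-- `S z` is conserved because `S ∘ L = 0`. -/
theorem Admissible.map_z_eq_zero (hD : D.Admissible S μ σ η φ) {w : ℝ → E} {l' z : ℝ → H} {T : ℝ}
    (h : D.IsSolutionOn (Icc 0 T) w l' z) (hz : S (z 0) = 0) {t : ℝ} (ht : t ∈ Icc 0 T) :
    S (z t) = 0 := by
  have hd : ∀ r ∈ Icc 0 T, HasDerivWithinAt (fun s => S (z s)) 0 (Ici 0) r := fun r hr => by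
    have := S.hasFDerivAt.comp_hasDerivWithinAt r (h.deriv_z r hr)
    simpa [Function.comp_def, velZ, hD.map_L] using this
  have := constant_of_has_deriv_right_zero (f := fun s => S (z s)) (a := 0) (b := T)
    (fun r hr => ((hd r hr).continuousWithinAt).mono Icc_subset_Ici_self)
    (fun r hr => (hd r (Ico_subset_Icc_self hr)).mono (Ici_subset_Ici.2 hr.1)) t ht
  rw [this, hz]

theorem Admissible.lyapunov_le (hD : D.Admissible S μ σ η φ) (he : D.IsEquilibrium S x l)
    {w : ℝ → E} {l' z : ℝ → H} {T : ℝ} (h : D.IsSolutionOn (Icc 0 T) w l' z)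
    (hz : S (z 0) = 0) {t : ℝ} (ht : t ∈ Icc 0 T) :
    D.lyapunov φ x l (w t) (l' t) (z t) ≤ D.lyapunov φ x l (w 0) (l' 0) (z 0) := by
  have hd := fun r (hr : r ∈ Icc 0 T) => hD.hasDerivWithinAt_lyapunov (x := x) (l := l) h hr
  refine image_le_of_deriv_right_le_deriv_boundary (a := 0) (b := T)
    (fun r hr => (hd r hr).continuousWithinAt.mono Icc_subset_Ici_self)
    (fun r hr => (hd r (Ico_subset_Icc_self hr)).mono (Ici_subset_Ici.2 hr.1)) le_rfl
    continuousOn_const (fun r _ => hasDerivWithinAt_const _ _ _) (fun r hr => ?_) ht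
  have h1 := hD.lyapunovDeriv_le he (w r) (l' r)
    (hD.map_z_eq_zero h hz (Ico_subset_Icc_self hr))
  have hα := hD.α_pos
  have hμ := hD.μ_pos
  exact h1.trans (neg_nonpos.2 (by positivity))

/-- By Young's inequality `exp (a t) (‖w‖² - K² / a²)` is nonincreasing. This bounds `w`, which the
Lyapunov function leaves free. -/
theorem norm_sq_le_of_norm_deriv_add_smul_le {w w' : ℝ → E} {T a K : ℝ} (ha : 0 < a)
    (hw : ∀ t ∈ Icc 0 T, HasDerivWithinAt w (w' t) (Ici 0) t)
    (hK : ∀ t ∈ Icc 0 T, ‖w' t + a • w t‖ ≤ K) {t : ℝ} (ht : t ∈ Icc 0 T) :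
    ‖w t‖ ^ 2 ≤ ‖w 0‖ ^ 2 + K ^ 2 / a ^ 2 := by
  have hd : ∀ r ∈ Icc 0 T, HasDerivWithinAt
      (fun s => Real.exp (a * s) * (‖w s‖ ^ 2 - K ^ 2 / a ^ 2))
      (Real.exp (a * r) * (a * 1) * (‖w r‖ ^ 2 - K ^ 2 / a ^ 2)
        + Real.exp (a * r) * (2 * inner ℝ (w r) (w' r))) (Ici 0) r := fun r hr =>
    ((((hasDerivAt_id r).const_mul a).exp.hasDerivWithinAt).mul
      ((hw r hr).norm_sq.sub_const (K ^ 2 / a ^ 2)))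
  have hle := image_le_of_deriv_right_le_deriv_boundary (a := 0) (b := T)
    (fun r hr => (hd r hr).continuousWithinAt.mono Icc_subset_Ici_self)
    (fun r hr => (hd r (Ico_subset_Icc_self hr)).mono (Ici_subset_Ici.2 hr.1)) le_rfl
    continuousOn_const (fun r _ => hasDerivWithinAt_const _ _ _) (fun r hr => by
      have hr' := Ico_subset_Icc_self hr
      have h1 : inner ℝ (w r) (w' r) = inner ℝ (w r) (w' r + a • w r) - a * ‖w r‖ ^ 2 := by
        rw [inner_add_right, inner_smul_right, real_inner_self_eq_norm_sq]; ring
      have h2 : inner ℝ (w r) (w' r + a • w r) ≤ ‖w r‖ * K :=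
        (real_inner_le_norm _ _).trans (by gcongr; exact hK r hr')
      have h3 : a * 1 * (‖w r‖ ^ 2 - K ^ 2 / a ^ 2) + 2 * inner ℝ (w r) (w' r) ≤ 0 := by
        have h4 : a * (K ^ 2 / a ^ 2) = K ^ 2 / a := by field_simp
        have h5 : 2 * (‖w r‖ * K) ≤ a * ‖w r‖ ^ 2 + K ^ 2 / a := by
          have : 0 ≤ (a * ‖w r‖ - K) ^ 2 / a := by positivity
          have h6 : (a * ‖w r‖ - K) ^ 2 / a = a * ‖w r‖ ^ 2 - 2 * (‖w r‖ * K) + K ^ 2 / a := by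
            field_simp
            ring
          linarith
        nlinarith
      have := mul_nonpos_of_nonneg_of_nonpos (Real.exp_pos (a * r)).le h3
      linarith) ht
  simp only [mul_zero, Real.exp_zero, one_mul] at hle
  have h1 : 1 ≤ Real.exp (a * t) := Real.one_le_exp (mul_nonneg ha.le ht.1)
  have h2 : 0 ≤ K ^ 2 / a ^ 2 := by positivity
  by_contra! hc
  have : ‖w t‖ ^ 2 - K ^ 2 / a ^ 2 ≤ Real.exp (a * t) * (‖w t‖ ^ 2 - K ^ 2 / a ^ 2) :=
    le_mul_of_one_le_left (by nlinarith [sq_nonneg ‖w 0‖]) h1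
  linarith

/-- A priori bound for the flow. -/
theorem Admissible.exists_bound [ProperSpace E] (hD : D.Admissible S μ σ η φ)
    (he : D.IsEquilibrium S x l) (w₀ : E) (l₀ z₀ : H) (hz : S z₀ = 0) :
    ∃ R, ∀ (T : ℝ) (w : ℝ → E) (l' z : ℝ → H), 0 ≤ T → D.IsSolutionOn (Icc 0 T) w l' z →
      w 0 = w₀ → l' 0 = l₀ → z 0 = z₀ → ‖w T‖ ≤ R ∧ ‖l' T‖ ≤ R ∧ ‖z T‖ ≤ R := by
  obtain ⟨R, hR, hb⟩ := hD.exists_bound_of_lyapunov_le (l := l) he.mem (D.lyapunov φ x l w₀ l₀ z₀)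
  obtain ⟨K, hK, hbK⟩ := hD.exists_bound_velW (l := l) he.mem (D.lyapunov φ x l w₀ l₀ z₀)
  refine ⟨max R (√(‖w₀‖ ^ 2 + K ^ 2 / D.α ^ 2)), fun T w l' z hT h hw hl hz0 => ?_⟩
  have hV : ∀ t ∈ Icc 0 T, D.lyapunov φ x l (w t) (l' t) (z t) ≤ D.lyapunov φ x l w₀ l₀ z₀ :=
    fun t ht => by
      have := hD.lyapunov_le he h (by rw [hz0, hz]) ht
      rwa [hw, hl, hz0] at this
  have hT' : T ∈ Icc 0 T := ⟨hT, le_rfl⟩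
  obtain ⟨-, h2, h3⟩ := hb _ _ _ (hV T hT')
  refine ⟨le_max_of_le_right (Real.le_sqrt_of_sq_le ?_), le_max_of_le_left h2,
    le_max_of_le_left h3⟩
  rw [← hw]
  exact norm_sq_le_of_norm_deriv_add_smul_le hD.α_pos h.deriv_w
    (fun t ht => hbK _ _ _ (hV t ht)) hT'

theorem IsSolutionOn.mono {s s' : Set ℝ} {w : ℝ → E} {l' z : ℝ → H} (h : D.IsSolutionOn s w l' z)
    (hs : s' ⊆ s) : D.IsSolutionOn s' w l' z :=
  ⟨fun t ht => h.deriv_w t (hs ht), fun t ht => h.deriv_l t (hs ht),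
    fun t ht => h.deriv_z t (hs ht)⟩

theorem Admissible.tendsto [ProperSpace E] (hD : D.Admissible S μ σ η φ)
    (he : D.IsEquilibrium S x l) {w : ℝ → E} {l' z : ℝ → H} (h : D.IsSolutionOn (Ici 0) w l' z)
    (hz : S (z 0) = 0) : Tendsto (fun t => D.P (w t)) atTop (𝓝 x) := by
  have hα := hD.α_pos
  have hμ := hD.μ_pos
  set C := D.lyapunov φ x l (w 0) (l' 0) (z 0) with hC
  have hI : ∀ t, D.IsSolutionOn (Icc 0 t) w l' z := fun t => h.mono Icc_subset_Ici_self
  have hV : ∀ t, 0 ≤ t → D.lyapunov φ x l (w t) (l' t) (z t) ≤ C := fun t ht =>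
    hD.lyapunov_le he (hI t) hz ⟨ht, le_rfl⟩
  obtain ⟨R, hR⟩ := hD.exists_bound he (w 0) (l' 0) (z 0) hz
  obtain ⟨R', hR'0, hR'⟩ := hD.exists_bound_of_lyapunov_le (l := l) he.mem C
  obtain ⟨K, hK0, hK⟩ := hD.exists_bound_velW (l := l) he.mem C
  have hvel : ∀ t ∈ Ici (0 : ℝ), ‖D.velW (w t) (l' t) (z t)‖ ≤ K + D.α * R := fun t ht => by
    have h1 := hK _ _ _ (hV t ht)
    have h2 := (hR t w l' z ht (hI t) rfl rfl rfl).1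
    have h3 : D.velW (w t) (l' t) (z t)
        = (D.velW (w t) (l' t) (z t) + D.α • w t) - D.α • w t := by abel
    rw [h3]
    refine (norm_sub_le _ _).trans (add_le_add h1 ?_)
    rw [norm_smul, Real.norm_of_nonneg hα.le]
    gcongr
  have hlip : ∀ s t, 0 ≤ s → 0 ≤ t → ‖D.P (w t) - D.P (w s)‖ ≤ (K + D.α * R) * |t - s| :=
    fun s t hs ht => (hD.isProjectionMap.norm_sub_le _ _).trans
      ((convex_Ici (0 : ℝ)).norm_image_sub_le_of_norm_hasDerivWithin_le h.deriv_w hvel hs ht)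
  -- `P` is nonexpansive and the velocity of `w` is bounded, so the bounded quantity `‖P w - x‖` is
  -- Lipschitz in time, and so is its square.
  have hlim : Tendsto (fun t => ‖D.P (w t) - x‖ ^ 2) atTop (𝓝 0) := by
    refine tendsto_zero_of_deriv_le_neg (ε := D.α * μ / 2) (C := 0)
      (K := 2 * (R' + ‖x‖) * (K + D.α * R)) (by positivity)
      (fun t ht => hD.hasDerivWithinAt_lyapunov (x := x) (l := l) h ht)
      (fun t ht => hD.lyapunovDeriv_le he _ _ (hD.map_z_eq_zero (hI t) hz ⟨ht, le_rfl⟩))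
      (fun t _ => by positivity)
      (fun t _ => le_trans (by positivity) (hD.norm_sq_le_lyapunov he.mem _ _ _).1) ?_
    intro s t hs hst
    have ht := hs.trans hst
    have hb : ∀ r, 0 ≤ r → ‖D.P (w r) - x‖ ≤ R' + ‖x‖ := fun r hr =>
      (norm_sub_le _ _).trans (by gcongr; exact (hR' _ _ _ (hV r hr)).1)
    have h1 : ‖D.P (w s) - x‖ - ‖D.P (w t) - x‖ ≤ (K + D.α * R) * (t - s) := by
      have := norm_sub_norm_le (D.P (w s) - x) (D.P (w t) - x)
      rw [sub_sub_sub_cancel_right] at this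
      have h2 := hlip t s ht hs
      rw [abs_sub_comm, abs_of_nonneg (sub_nonneg.2 hst)] at h2
      exact this.trans h2
    have h3 : 0 ≤ (K + D.α * R) * (t - s) :=
      mul_nonneg ((norm_nonneg _).trans (hvel 0 self_mem_Ici)) (sub_nonneg.2 hst)
    calc ‖D.P (w s) - x‖ ^ 2 - ‖D.P (w t) - x‖ ^ 2
        = (‖D.P (w s) - x‖ + ‖D.P (w t) - x‖) * (‖D.P (w s) - x‖ - ‖D.P (w t) - x‖) := by ring
      _ ≤ (‖D.P (w s) - x‖ + ‖D.P (w t) - x‖) * ((K + D.α * R) * (t - s)) := by gcongr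
      _ ≤ (2 * (R' + ‖x‖)) * ((K + D.α * R) * (t - s)) := by
          gcongr
          linarith [hb s hs, hb t ht]
      _ = _ := by ring
  rw [tendsto_iff_norm_sub_tendsto_zero]
  have := hlim.sqrt
  simpa using this

end ProjFlow

/-! ### Global existence for the abstract flow. -/

namespace ProjFlow

open scoped NNReal

section Lipschitz

variable {Y V W : Type*} [PseudoMetricSpace Y] [NormedAddCommGroup V] [NormedAddCommGroup W]

/-- Globally Lipschitz with some constant. -/
def IsLipschitz (f : Y → V) : Prop := ∃ K : ℝ≥0, LipschitzWith K f

theorem IsLipschitz.add {f g : Y → V} (hf : IsLipschitz f) (hg : IsLipschitz g) :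
    IsLipschitz fun y => f y + g y :=
  let ⟨_, h⟩ := hf; let ⟨_, h'⟩ := hg; ⟨_, h.add h'⟩

theorem IsLipschitz.sub {f g : Y → V} (hf : IsLipschitz f) (hg : IsLipschitz g) :
    IsLipschitz fun y => f y - g y :=
  let ⟨_, h⟩ := hf; let ⟨_, h'⟩ := hg; ⟨_, h.sub h'⟩

theorem IsLipschitz.sub_const {f : Y → V} (hf : IsLipschitz f) (c : V) :
    IsLipschitz fun y => f y - c :=
  hf.sub ⟨0, LipschitzWith.const c⟩

theorem IsLipschitz.clm_comp [NormedSpace ℝ V] [NormedSpace ℝ W] (T : V →L[ℝ] W) {f : Y → V}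
    (hf : IsLipschitz f) : IsLipschitz fun y => T (f y) :=
  let ⟨_, h⟩ := hf; ⟨_, T.lipschitz.comp h⟩

theorem IsLipschitz.const_smul [NormedSpace ℝ V] (c : ℝ) {f : Y → V} (hf : IsLipschitz f) :
    IsLipschitz fun y => c • f y :=
  hf.clm_comp (c • ContinuousLinearMap.id ℝ V)

theorem IsLipschitz.neg {f : Y → V} (hf : IsLipschitz f) : IsLipschitz fun y => -f y :=
  let ⟨_, h⟩ := hf; ⟨_, h.neg⟩

theorem IsLipschitz.prodMk {f : Y → V} {g : Y → W} (hf : IsLipschitz f) (hg : IsLipschitz g) :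
    IsLipschitz fun y => (f y, g y) :=
  let ⟨_, h⟩ := hf; let ⟨_, h'⟩ := hg; ⟨_, h.prodMk h'⟩

theorem IsLipschitz.comp_lipschitzWith {K : ℝ≥0} {g : V → W} (hg : LipschitzWith K g) {f : Y → V}
    (hf : IsLipschitz f) : IsLipschitz fun y => g (f y) :=
  let ⟨_, h⟩ := hf; ⟨_, hg.comp h⟩

end Lipschitz

variable {E H F : Type*} [NormedAddCommGroup E] [InnerProductSpace ℝ E] [ProperSpace E]
  [NormedAddCommGroup H] [InnerProductSpace ℝ H] [CompleteSpace H] [NormedAddCommGroup F]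
  [NormedSpace ℝ F] {D : ProjFlow E H} {S : H →L[ℝ] F} {μ σ η φ : ℝ} {x : E} {l : H}

theorem _root_.exists_isProjectionMap_closedBall {G : Type*} [NormedAddCommGroup G]
    [InnerProductSpace ℝ G] [CompleteSpace G] {R : ℝ} (hR : 0 ≤ R) :
    ∃ ρ : G → G, IsProjectionMap (Metric.closedBall 0 R) ρ ∧ (∀ y, ‖ρ y‖ ≤ R) ∧
      ∀ y, ‖y‖ ≤ R → ρ y = y := by
  obtain ⟨ρ, hρ⟩ := exists_isProjectionMap (E := G) (X := Metric.closedBall 0 R)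
    ⟨0, by simpa using hR⟩ Metric.isClosed_closedBall (convex_closedBall 0 R)
  refine ⟨ρ, hρ, fun y => by simpa using (hρ y).1, fun y hy => ?_⟩
  exact hρ.eq_of_inner_le_zero (by simpa using hy) (by simp)

/-- The flow has a global solution for any initial value with `S z₀ = 0`. -/
theorem Admissible.exists_isSolutionOn (hD : D.Admissible S μ σ η φ) (he : D.IsEquilibrium S x l)
    (w₀ : E) (l₀ z₀ : H) (hz : S z₀ = 0) :
    ∃ (w : ℝ → E) (l' z : ℝ → H), D.IsSolutionOn (Ici 0) w l' z ∧
      w 0 = w₀ ∧ l' 0 = l₀ ∧ z 0 = z₀ := by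
  obtain ⟨R₀, hR₀⟩ := hD.exists_bound he w₀ l₀ z₀ hz
  let R := |R₀| + 1
  have hR : 0 ≤ R := by positivity
  have hR₀R : R₀ < R := (le_abs_self R₀).trans_lt (lt_add_one _)
  obtain ⟨ρ, hρ, hρR, hρid⟩ := exists_isProjectionMap_closedBall (G := E) hR
  obtain ⟨τ, hτ, hτR, hτid⟩ := exists_isProjectionMap_closedBall (G := H) hR
  -- The product carries the sup norm, so its ball is a product of balls and the retraction acts by
  -- components.
  let r : E × H × H → E × H × H := fun y => (ρ y.1, τ y.2.1, τ y.2.2)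
  let v : E × H × H → E × H × H := fun y =>
    (D.velW y.1 y.2.1 y.2.2, D.velL y.1 y.2.1 y.2.2, D.velZ y.2.1)
  have hr : ∀ y, ‖y‖ ≤ R → r y = y := fun y hy => by
    have h1 := (norm_fst_le y).trans hy
    have h2 := (norm_snd_le y).trans hy
    simp only [r, hρid _ h1, hτid _ ((norm_fst_le y.2).trans h2),
      hτid _ ((norm_snd_le y.2).trans h2)]
  have hrR : ∀ y, ‖r y‖ ≤ R := fun y =>
    norm_prod_le_iff.2 ⟨hρR _, norm_prod_le_iff.2 ⟨hτR _, hτR _⟩⟩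
  have lw : IsLipschitz fun y : E × H × H => ρ y.1 :=
    IsLipschitz.comp_lipschitzWith hρ.lipschitzWith ⟨1, LipschitzWith.prod_fst⟩
  have ll : IsLipschitz fun y : E × H × H => τ y.2.1 :=
    IsLipschitz.comp_lipschitzWith (hτ.lipschitzWith.comp LipschitzWith.prod_fst)
      (f := fun y : E × H × H => y.2) ⟨1, LipschitzWith.prod_snd⟩
  have lz : IsLipschitz fun y : E × H × H => τ y.2.2 :=
    IsLipschitz.comp_lipschitzWith (hτ.lipschitzWith.comp LipschitzWith.prod_snd)
      (f := fun y : E × H × H => y.2) ⟨1, LipschitzWith.prod_snd⟩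
  have lP : IsLipschitz fun y : E × H × H => D.P (ρ y.1) :=
    IsLipschitz.comp_lipschitzWith hD.isProjectionMap.lipschitzWith lw
  have lg : IsLipschitz fun y : E × H × H => D.g (D.P (ρ y.1)) := by
    -- `g` is only locally Lipschitz on `X`, but `P ∘ ρ` takes values in the compact set `s`, where
    -- a single constant works.
    let s : Set E := Metric.closedBall 0 (R + ‖D.P 0‖) ∩ D.X
    have hs : IsCompact s := (isCompact_closedBall 0 _).inter_right hD.isClosed
    obtain ⟨K, hK⟩ := (hD.locallyLipschitzOn.mono
      (inter_subset_right : s ⊆ D.X)).exists_lipschitzOnWith_of_compact hs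
    obtain ⟨K', hK'⟩ := lP
    refine ⟨K * K', lipschitzOnWith_univ.1 (hK.comp hK'.lipschitzOnWith fun y _ => ⟨?_, ?_⟩)⟩
    · have h1 := hD.isProjectionMap.norm_sub_le (ρ y.1) 0
      rw [sub_zero] at h1
      have h2 := norm_le_norm_add_norm_sub (D.P 0) (D.P (ρ y.1))
      rw [norm_sub_rev] at h2
      rw [mem_closedBall_zero_iff]
      linarith [hρR y.1]
    · exact (hD.isProjectionMap _).1
  have lm : IsLipschitz fun y : E × H × H => D.residual (ρ y.1) (τ y.2.2) :=
    ((lP.clm_comp D.A).sub_const D.b).sub lz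
  have lv : IsLipschitz fun y => v (r y) :=
    IsLipschitz.prodMk (((((lw.sub lP).add lg).add (ll.clm_comp D.B)).const_smul D.α).neg.sub
        (lm.clm_comp D.B))
      (IsLipschitz.prodMk (lm.sub ((ll.clm_comp D.L).const_smul D.β))
        ((ll.clm_comp D.L).const_smul _))
  obtain ⟨K, hK⟩ := lv
  have hbd : ∀ y, ‖v (r y)‖ ≤ (⟨‖v (r 0)‖ + K * R, by positivity⟩ : ℝ≥0) := fun y => by
    -- Evaluate at `r y` instead of `y`: `r` is idempotent and `‖r y‖ ≤ R`, so the bound is uniform.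
    have h1 := hK.norm_sub_le (r y) 0
    rw [sub_zero, hr _ (hrR y)] at h1
    have h2 := norm_le_norm_add_norm_sub (v (r 0)) (v (r y))
    rw [norm_sub_rev] at h2
    have h3 : K * ‖r y‖ ≤ K * R := by gcongr; exact hrR y
    change ‖v (r y)‖ ≤ ‖v (r 0)‖ + K * R
    linarith
  have hsol : ∀ (s : Set ℝ) (u : ℝ → E × H × H),
      (∀ t ∈ s, HasDerivWithinAt u (v (u t)) (Ici 0) t) →
      D.IsSolutionOn s (fun t => (u t).1) (fun t => (u t).2.1) fun t => (u t).2.2 := by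
    intro s u h
    have h1 := fun t ht => (ContinuousLinearMap.fst ℝ E (H × H)).hasFDerivAt.comp_hasDerivWithinAt
      t (h t ht)
    have h2 := fun t ht => (ContinuousLinearMap.snd ℝ E (H × H)).hasFDerivAt.comp_hasDerivWithinAt
      t (h t ht)
    exact ⟨h1, fun t ht =>
        (ContinuousLinearMap.fst ℝ H H).hasFDerivAt.comp_hasDerivWithinAt t (h2 t ht),
      fun t ht => (ContinuousLinearMap.snd ℝ H H).hasFDerivAt.comp_hasDerivWithinAt t (h2 t ht)⟩
  obtain ⟨u, hu0, hu⟩ := exists_hasDerivWithinAt_of_truncation (v := v) (R := R) hK hbd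
    (fun y hy => by rw [hr y hy]) (w₀, l₀, z₀) (fun T u hT hu0 hu => by
      obtain ⟨h1, h2, h3⟩ := hR₀ T _ _ _ hT (hsol _ u hu) (by simp [hu0]) (by simp [hu0])
        (by simp [hu0])
      exact (norm_prod_le_iff.2 ⟨h1, norm_prod_le_iff.2 ⟨h2, h3⟩⟩).trans_lt hR₀R)
  exact ⟨_, _, _, hsol _ u hu, by simp [hu0], by simp [hu0], by simp [hu0]⟩

end ProjFlow

/-! ### The spectral gap of a positive semidefinite operator. -/

section SpectralGap

variable {V ι : Type*} [NormedAddCommGroup V] [InnerProductSpace ℝ V] [Fintype ι]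

/-- If `T` is positive semidefinite with kernel spanned by `u`, then its second smallest eigenvalue
`η` is positive and bounds the quadratic form of `T` from below on the complement of `u`. -/
theorem LinearMap.IsSymmetric.spectral_gap {T : V →ₗ[ℝ] V} (hT : T.IsSymmetric)
    (e : OrthonormalBasis ι ℝ V) {ev : ι → ℝ} (he : ∀ k, T (e k) = ev k • e k) {η : ℝ} {k₀ k₁ : ι}
    (hk : k₀ ≠ k₁) (h0 : ev k₀ = η) (h1 : ev k₁ ≤ η) (hη : ∀ k, k ≠ k₁ → η ≤ ev k)
    (hpos : ∀ v, 0 ≤ inner ℝ v (T v)) {u : V} (hu : u ≠ 0) (hTu : T u = 0)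
    (hker : ∀ v, T v = 0 → ∃ c : ℝ, v = c • u) :
    0 < η ∧ ∀ v, inner ℝ v u = 0 → η * ‖v‖ ^ 2 ≤ inner ℝ v (T v) := by
  have hev : ∀ k, 0 ≤ ev k := fun k => by
    have := hpos (e k)
    rwa [he, inner_smul_right, real_inner_self_eq_norm_sq, e.orthonormal.1 k, one_pow,
      mul_one] at this
  have hη0 : 0 < η := by
    -- Otherwise two orthogonal eigenvectors would lie in the kernel, a line.
    by_contra! hle
    have hz0 : ev k₀ = 0 := le_antisymm (h0.le.trans hle) (hev _)
    have hz1 : ev k₁ = 0 := le_antisymm (h1.trans hle) (hev _)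
    obtain ⟨a, ha⟩ := hker (e k₀) (by rw [he, hz0, zero_smul])
    obtain ⟨c, hc⟩ := hker (e k₁) (by rw [he, hz1, zero_smul])
    have h2 := e.orthonormal.2 hk
    simp only [ha, hc, inner_smul_left, inner_smul_right, mul_eq_zero, inner_self_eq_zero, hu,
      or_false, conj_trivial] at h2
    rcases h2 with h2 | h2
    · exact e.orthonormal.ne_zero k₁ (by rw [hc, h2, zero_smul])
    · exact e.orthonormal.ne_zero k₀ (by rw [ha, h2, zero_smul])
  refine ⟨hη0, fun v hv => ?_⟩
  have hcoef : ∀ v k, inner ℝ (e k) (T v) = ev k * inner ℝ (e k) v := fun v k => by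
    rw [← hT, he, inner_smul_left]; rfl
  -- `T u = 0` forces `u` to be orthogonal to every eigenvector with positive eigenvalue. Only the
  -- component along `e k₁` survives, so `v ⟂ u` means `v ⟂ e k₁`.
  have hku : ∀ k, k ≠ k₁ → inner ℝ (e k) u = 0 := fun k hkk => by
    have := hcoef u k
    rw [hTu, inner_zero_right, zero_eq_mul] at this
    exact this.resolve_left (hη0.trans_le (hη k hkk)).ne'
  have hk1u : inner ℝ (e k₁) u ≠ 0 := fun h => hu <| by
    rw [← e.sum_repr' u]
    refine Finset.sum_eq_zero fun k _ => ?_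
    rcases eq_or_ne k k₁ with rfl | h'
    · rw [h, zero_smul]
    · rw [hku k h', zero_smul]
  have hvk1 : inner ℝ v (e k₁) = 0 := by
    have h2 := e.sum_inner_mul_inner v u
    rw [Finset.sum_eq_single k₁ (fun k _ hkk => by rw [hku k hkk, mul_zero]) (by simp), hv,
      mul_eq_zero] at h2
    exact h2.resolve_right hk1u
  rw [← real_inner_self_eq_norm_sq, ← e.sum_inner_mul_inner v v, ← e.sum_inner_mul_inner v (T v),
    Finset.mul_sum]
  refine Finset.sum_le_sum fun k _ => ?_
  rw [hcoef, real_inner_comm (e k) v]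
  rcases eq_or_ne k k₁ with rfl | h'
  · rw [real_inner_comm, hvk1]; simp
  · nlinarith [hη k h', mul_self_nonneg (inner ℝ (e k) v)]

end SpectralGap

/-! ### Laplacians of weight-balanced digraphs. -/

namespace WeightedDigraph

variable {n : ℕ} (G : WeightedDigraph n)

theorem laplacian_mulVec (v : Fin n → ℝ) (i : Fin n) :
    (G.laplacian.mulVec v) i = ∑ j, G.weight i j * (v i - v j) := by
  rw [laplacian, Matrix.sub_mulVec, Pi.sub_apply, Matrix.mulVec_diagonal]
  simp only [outDegree, Matrix.mulVec, dotProduct, mul_sub, Finset.sum_sub_distrib, Finset.sum_mul]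

theorem dotProduct_symmLaplacian_mulVec (v : Fin n → ℝ) :
    v ⬝ᵥ G.symmLaplacian.mulVec v = v ⬝ᵥ G.laplacian.mulVec v := by
  rw [symmLaplacian, Matrix.smul_mulVec, Matrix.add_mulVec, dotProduct_smul, dotProduct_add,
    Matrix.mulVec_transpose, dotProduct_comm v (Matrix.vecMul v _), ← Matrix.dotProduct_mulVec,
    smul_eq_mul]
  ring

variable {G}

theorem WeightBalanced.sum_weight_mul (hbal : G.WeightBalanced) (c : Fin n → ℝ) :
    ∑ i, ∑ j, G.weight i j * c j = ∑ i, ∑ j, G.weight i j * c i := by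
  rw [Finset.sum_comm]
  refine Finset.sum_congr rfl fun i _ => ?_
  rw [← Finset.sum_mul, ← Finset.sum_mul]
  exact congrArg (· * c i) (hbal i)

theorem WeightBalanced.sum_laplacian_smul {M : Type*} [AddCommGroup M] [Module ℝ M]
    (hbal : G.WeightBalanced) (l : Fin n → M) :
    ∑ i, ∑ j, G.weight i j • (l i - l j) = 0 := by
  simp only [smul_sub, Finset.sum_sub_distrib]
  rw [Finset.sum_comm (f := fun i j => G.weight i j • l j), sub_eq_zero]
  refine Finset.sum_congr rfl fun i _ => ?_
  rw [← Finset.sum_smul, ← Finset.sum_smul]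
  exact congrArg (· • l i) (hbal i).symm

/-- Expanding the squares, balance makes the `v i ^ 2` and `v j ^ 2` sums equal. With strong
connectivity, a vanishing form then forces consensus. -/
theorem WeightBalanced.dotProduct_laplacian_mulVec (hbal : G.WeightBalanced) (v : Fin n → ℝ) :
    v ⬝ᵥ G.laplacian.mulVec v = ∑ i, ∑ j, G.weight i j * (v i - v j) ^ 2 / 2 := by
  have h := hbal.sum_weight_mul fun i => v i ^ 2
  simp only [dotProduct, laplacian_mulVec, Finset.mul_sum]
  have h2 : ∑ i, ∑ j, G.weight i j * (v i - v j) ^ 2 / 2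
      = ∑ i, ∑ j, (v i * (G.weight i j * (v i - v j))
        + (G.weight i j * v j ^ 2 / 2 - G.weight i j * v i ^ 2 / 2)) := by
    refine Finset.sum_congr rfl fun i _ => Finset.sum_congr rfl fun j _ => ?_
    ring
  rw [h2]
  simp only [Finset.sum_add_distrib, Finset.sum_sub_distrib, ← Finset.sum_div]
  rw [h, sub_self, add_zero]

theorem WeightBalanced.symmLaplacian_mulVec_one (hbal : G.WeightBalanced) :
    G.symmLaplacian.mulVec (fun _ => 1) = 0 := by
  have h1 : G.laplacian.mulVec (fun _ => 1) = 0 := by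
    ext i
    simp [laplacian_mulVec]
  have h2 : G.laplacian.transpose.mulVec (fun _ => 1) = 0 := by
    ext i
    have := hbal i
    rw [inDegree] at this
    simp [laplacian, Matrix.mulVec, dotProduct, Finset.sum_sub_distrib, this,
      Matrix.diagonal_apply]
  rw [symmLaplacian, Matrix.smul_mulVec, Matrix.add_mulVec, h1, h2, add_zero, smul_zero]

theorem StronglyConnected.eq_of_forall_edge {M : Type*} (hconn : G.StronglyConnected)
    {v : Fin n → M} (h : ∀ i j, G.Edge i j → v i = v j) (i j : Fin n) : v i = v j := by
  induction hconn i j with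
  | refl => rfl
  | tail _ hbc ih => exact ih.trans (h _ _ hbc)

theorem WeightBalanced.dotProduct_laplacian_mulVec_nonneg (hbal : G.WeightBalanced)
    (v : Fin n → ℝ) : 0 ≤ v ⬝ᵥ G.laplacian.mulVec v := by
  rw [hbal.dotProduct_laplacian_mulVec]
  exact Finset.sum_nonneg fun i _ => Finset.sum_nonneg fun j _ =>
    div_nonneg (mul_nonneg (G.weight_nonneg i j) (sq_nonneg _)) zero_le_two

theorem eq_of_dotProduct_laplacian_mulVec_eq_zero (hconn : G.StronglyConnected)
    (hbal : G.WeightBalanced) {v : Fin n → ℝ} (hv : v ⬝ᵥ G.laplacian.mulVec v = 0) (i j : Fin n) :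
    v i = v j := by
  refine hconn.eq_of_forall_edge (fun i j hij => ?_) i j
  rw [hbal.dotProduct_laplacian_mulVec] at hv
  have hnn : ∀ i j, 0 ≤ G.weight i j * (v i - v j) ^ 2 / 2 := fun i j =>
    div_nonneg (mul_nonneg (G.weight_nonneg i j) (sq_nonneg _)) zero_le_two
  rw [Finset.sum_eq_zero_iff_of_nonneg fun i _ => Finset.sum_nonneg fun j _ => hnn i j] at hv
  have h2 := (Finset.sum_eq_zero_iff_of_nonneg fun j _ => hnn i j).1 (hv i (Finset.mem_univ _)) j
    (Finset.mem_univ _)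
  have hw : 0 < G.weight i j := hij
  have h3 : (v i - v j) ^ 2 = 0 := by
    rcases mul_eq_zero.1 (div_eq_zero_iff.1 h2 |>.resolve_right two_ne_zero) with h | h
    · exact absurd h hw.ne'
    · exact h
  exact sub_eq_zero.1 (pow_eq_zero_iff two_ne_zero |>.1 h3)

theorem spectral_gap (hn : 2 ≤ n) (hconn : G.StronglyConnected) (hbal : G.WeightBalanced) :
    0 < secondSmallestEigenvalue hn G.symmLaplacian_isHermitian ∧
    ∀ v : Fin n → ℝ, ∑ i, v i = 0 →
      secondSmallestEigenvalue hn G.symmLaplacian_isHermitian * ∑ i, v i ^ 2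
        ≤ v ⬝ᵥ G.laplacian.mulVec v := by
  set M := G.symmLaplacian with hM
  set hH := G.symmLaplacian_isHermitian
  let T := Matrix.toEuclideanLin M
  have hT : T.IsSymmetric := Matrix.isSymmetric_toEuclideanLin_iff.2 hH
  let s := (Fintype.equivOfCardEq (Fintype.card_fin (Fintype.card (Fin n))) :
    Fin (Fintype.card (Fin n)) ≃ Fin n)
  have hcard : Fintype.card (Fin n) = n := Fintype.card_fin n
  have hev : ∀ k, hH.eigenvalues (s k) = hH.eigenvalues₀ k := fun k => by
    rw [Matrix.IsHermitian.eigenvalues, Equiv.symm_apply_apply]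
  have hquad : ∀ v : EuclideanSpace ℝ (Fin n),
      inner ℝ v (T v) = v.ofLp ⬝ᵥ G.laplacian.mulVec v.ofLp := fun v => by
    rw [← dotProduct_symmLaplacian_mulVec, EuclideanSpace.inner_eq_star_dotProduct, dotProduct_comm]
    simp [T, hM]
  have hgap := hT.spectral_gap hH.eigenvectorBasis (ev := hH.eigenvalues)
    -- The eigenvalues are listed in decreasing order, so `n - 1` indexes the smallest and `n - 2`
    -- the next; the kernel is spanned by the all-ones vector.
    (η := secondSmallestEigenvalue hn hH) (k₀ := s ⟨n - 2, by omega⟩) (k₁ := s ⟨n - 1, by omega⟩)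
    (u := WithLp.toLp 2 fun _ => (1 : ℝ))
    (fun k => by
      ext i
      simpa [T] using congrFun (hH.mulVec_eigenvectorBasis k) i)
    (fun h => by
      have := Fin.mk.inj_iff.1 (s.injective h)
      omega)
    (hev _)
    (by
      rw [hev]
      exact hH.eigenvalues₀_antitone (Fin.mk_le_mk.2 (by omega)))
    (fun k hk => by
      obtain ⟨k, rfl⟩ := s.surjective k
      rw [hev]
      have : k.1 ≠ n - 1 := fun h => hk (congrArg s (Fin.ext h))
      exact hH.eigenvalues₀_antitone (Fin.le_def.2 (by
        have := k.2
        change k.1 ≤ n - 2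
        omega)))
    (fun v => by
      rw [hquad]
      exact hbal.dotProduct_laplacian_mulVec_nonneg _)
    (fun h => by
      have := congrArg (fun v : EuclideanSpace ℝ (Fin n) => v ⟨0, by omega⟩) h
      simp at this)
    (by
      ext i
      simpa [T] using congrFun hbal.symmLaplacian_mulVec_one i)
    (fun v hv => by
      have h := hquad v
      rw [hv, inner_zero_right] at h
      refine ⟨v ⟨0, by omega⟩, ?_⟩
      ext i
      simpa using eq_of_dotProduct_laplacian_mulVec_eq_zero hconn hbal h.symm i ⟨0, by omega⟩)
  refine ⟨hgap.1, fun v hv => ?_⟩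
  have := hgap.2 (WithLp.toLp 2 v) (by simpa [PiLp.inner_apply] using hv)
  rw [hquad, EuclideanSpace.real_norm_sq_eq] at this
  exact this

/-- Subtracting the mean leaves the differences unchanged, and by balance `L v` sums to zero, so the
form is unchanged too. -/
theorem spectral_gap_sub_mean (hn : 2 ≤ n) (hconn : G.StronglyConnected) (hbal : G.WeightBalanced)
    (v : Fin n → ℝ) :
    secondSmallestEigenvalue hn G.symmLaplacian_isHermitian * ∑ i, (v i - (n : ℝ)⁻¹ * ∑ j, v j) ^ 2
      ≤ ∑ i, v i * ∑ j, G.weight i j * (v i - v j) := by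
  have hn0 : (n : ℝ) ≠ 0 := by
    have : n ≠ 0 := by omega
    exact_mod_cast this
  refine ((spectral_gap hn hconn hbal).2 (fun i => v i - (n : ℝ)⁻¹ * ∑ j, v j) ?_).trans_eq ?_
  · rw [Finset.sum_sub_distrib]
    simp [hn0]
  · simp only [dotProduct, laplacian_mulVec, sub_sub_sub_cancel_right, sub_mul,
      Finset.sum_sub_distrib]
    rw [← Finset.mul_sum]
    have := hbal.sum_laplacian_smul v
    simp only [smul_eq_mul] at this
    rw [this, mul_zero, sub_zero]

end WeightedDigraph

/-! ### Singular values as operator bounds. -/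

section SingularValue

/-- Expand `‖T v‖² = ⟨v, T* T v⟩` in an eigenbasis of `T* T`, whose eigenvalues are the squared
singular values. -/
theorem LinearMap.norm_apply_le_singularValues_zero {V W : Type*} [NormedAddCommGroup V]
    [InnerProductSpace ℝ V] [FiniteDimensional ℝ V] [NormedAddCommGroup W] [InnerProductSpace ℝ W]
    [FiniteDimensional ℝ W] (T : V →ₗ[ℝ] W) (v : V) : ‖T v‖ ≤ T.singularValues 0 * ‖v‖ := by
  have h0 := T.singularValues_nonneg 0
  refine le_of_sq_le_sq ?_ (by positivity)
  let e := T.isSymmetric_adjoint_comp_self.eigenvectorBasis rfl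
  have hT : ‖T v‖ ^ 2 = inner ℝ v ((T.adjoint ∘ₗ T) v) := by
    rw [LinearMap.comp_apply, LinearMap.adjoint_inner_right, real_inner_self_eq_norm_sq]
  rw [hT, mul_pow, ← real_inner_self_eq_norm_sq v, ← e.sum_inner_mul_inner v v,
    ← e.sum_inner_mul_inner v ((T.adjoint ∘ₗ T) v), Finset.mul_sum]
  refine Finset.sum_le_sum fun k _ => ?_
  have h1 : inner ℝ (e k) ((T.adjoint ∘ₗ T) v) = T.singularValues k ^ 2 * inner ℝ (e k) v := by
    rw [← T.isSymmetric_adjoint_comp_self, LinearMap.IsSymmetric.apply_eigenvectorBasis,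
      inner_smul_left, T.sq_singularValues_fin rfl]
    rfl
  have h2 : T.singularValues k ^ 2 ≤ T.singularValues 0 ^ 2 :=
    pow_le_pow_left₀ (T.singularValues_nonneg _) (T.singularValues_antitone (Nat.zero_le _)) 2
  rw [h1, real_inner_comm (e k) v]
  nlinarith [mul_self_nonneg (inner ℝ (e k) v)]

theorem sum_norm_sq_le_largestSingularValue {ι : Type*} [Fintype ι] [DecidableEq ι]
    {m k : ι → Type*} [∀ i, Fintype (m i)] [∀ i, Fintype (k i)] [∀ i, DecidableEq (k i)]
    (A : ∀ i, Matrix (m i) (k i) ℝ) (x : ∀ i, EuclideanSpace ℝ (k i)) :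
    ∑ i, ‖Matrix.toEuclideanLin (A i) (x i)‖ ^ 2
      ≤ largestSingularValue (Matrix.blockDiagonal' A) ^ 2 * ∑ i, ‖x i‖ ^ 2 := by
  let v : EuclideanSpace ℝ (Σ i, k i) := WithLp.toLp 2 fun r => x r.1 r.2
  have h := pow_le_pow_left₀ (norm_nonneg _) ((Matrix.toEuclideanLin
    (Matrix.blockDiagonal' A)).norm_apply_le_singularValues_zero v) 2
  rw [mul_pow] at h
  have hv : ‖v‖ ^ 2 = ∑ i, ‖x i‖ ^ 2 := by
    simp only [EuclideanSpace.real_norm_sq_eq, Fintype.sum_sigma, v]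
  have hA : ‖Matrix.toEuclideanLin (Matrix.blockDiagonal' A) v‖ ^ 2
      = ∑ i, ‖Matrix.toEuclideanLin (A i) (x i)‖ ^ 2 := by
    simp only [EuclideanSpace.real_norm_sq_eq, Fintype.sum_sigma]
    refine Finset.sum_congr rfl fun i _ => Finset.sum_congr rfl fun j _ => ?_
    congr 1
    simp only [Matrix.toLpLin_apply, Matrix.mulVec, dotProduct, Fintype.sum_sigma, v,
      Matrix.blockDiagonal'_apply]
    rw [Finset.sum_eq_single i]
    · simp
    · intro b _ hb
      simp [hb.symm]
    · simp
  rw [hv, hA] at h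
  exact h

theorem inner_toEuclideanLin_left {m k : Type*} [Fintype m] [Fintype k] [DecidableEq m]
    [DecidableEq k] (A : Matrix m k ℝ) (x : EuclideanSpace ℝ k) (y : EuclideanSpace ℝ m) :
    inner ℝ (Matrix.toEuclideanLin A x) y = inner ℝ x (Matrix.toEuclideanLin A.transpose y) := by
  rw [← Matrix.conjTranspose_eq_transpose_of_trivial,
    Matrix.toEuclideanLin_conjTranspose_eq_adjoint,
    LinearMap.adjoint_inner_right]

end SingularValue

/-! ### Existence, uniqueness and multipliers of the optimum. -/

section Optimum

variable {n p : ℕ} {d : Fin n → ℕ} {f : ∀ i, EuclideanSpace ℝ (Fin (d i)) → ℝ}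
  {X : ∀ i, Set (EuclideanSpace ℝ (Fin (d i)))} {A : ∀ i, Matrix (Fin p) (Fin (d i)) ℝ}
  {c : EuclideanSpace ℝ (Fin p)} {μ : Fin n → ℝ}

/-- The linear map `x ↦ ∑ A_i x_i`. -/
def coupling (A : ∀ i, Matrix (Fin p) (Fin (d i)) ℝ) :
    Stacked d →ₗ[ℝ] EuclideanSpace ℝ (Fin p) :=
  ∑ i, Matrix.toEuclideanLin (A i) ∘ₗ LinearMap.proj i

theorem coupling_apply (x : Stacked d) :
    coupling A x = ∑ i, Matrix.toEuclideanLin (A i) (x i) := by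
  simp [coupling]

theorem isClosed_feasibleSet (hX : ∀ i, IsClosed (X i)) : IsClosed (feasibleSet X A c) := by
  have h : feasibleSet X A c = (coupling A) ⁻¹' {c} ∩ univ.pi X := by
    ext x
    simp [feasibleSet, coupling_apply]
  rw [h]
  exact (isClosed_singleton.preimage (coupling A).continuous_of_finiteDimensional).inter
    (isClosed_set_pi fun i _ => hX i)

theorem convex_feasibleSet (hX : ∀ i, Convex ℝ (X i)) : Convex ℝ (feasibleSet X A c) := by
  have h : feasibleSet X A c = (coupling A) ⁻¹' {c} ∩ univ.pi X := by
    ext x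
    simp [feasibleSet, coupling_apply]
  rw [h]
  exact ((convex_singleton c).linear_preimage (coupling A)).inter (convex_pi fun i _ => hX i)

theorem exists_isOptimalSolution (hX : ∀ i, IsClosed (X i))
    (hd : ∀ i, ∀ x ∈ X i, DifferentiableAt ℝ (f i) x) (hμ : ∀ i, 0 < μ i)
    (hf : ∀ i, StrongConvexOn (X i) (μ i) (f i)) (hne : (feasibleSet X A c).Nonempty) :
    ∃ x, IsOptimalSolution f X A c x := by
  obtain ⟨x₀, hx₀⟩ := hne
  have hmem : ∀ {y}, y ∈ feasibleSet X A c → ∀ i, y i ∈ X i := fun hy i => hy.2 i (mem_univ i)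
  let γ : Fin n → ℝ := fun i => ‖gradient (f i) (x₀ i)‖
  let C : ℝ := ∑ i, γ i ^ 2 / μ i
  -- Quadratic growth, by completing the square against the linear term. Any feasible point with a
  -- smaller value than `x₀` therefore lies in the compact set `K`.
  have hgrow : ∀ i, ∀ y ∈ X i,
      f i (x₀ i) + (μ i / 4 * ‖y - x₀ i‖ ^ 2 - γ i ^ 2 / μ i) ≤ f i y := fun i y hy => by
    have h1 := (hf i).add_inner_gradient_le (hmem hx₀ i) hy (hd i _ (hmem hx₀ i))
    have h2 := neg_le_of_abs_le (abs_real_inner_le_norm (gradient (f i) (x₀ i)) (y - x₀ i))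
    have h3 : 0 ≤ (μ i / 2 * ‖y - x₀ i‖ - γ i) ^ 2 / μ i :=
      div_nonneg (sq_nonneg _) (hμ i).le
    have h4 : (μ i / 2 * ‖y - x₀ i‖ - γ i) ^ 2 / μ i
        = μ i / 4 * ‖y - x₀ i‖ ^ 2 - γ i * ‖y - x₀ i‖ + γ i ^ 2 / μ i := by
      have := (hμ i).ne'
      field_simp
      ring
    have h5 : γ i = ‖gradient (f i) (x₀ i)‖ := rfl
    rw [← h5] at h2
    linarith
  let K : Set (Stacked d) :=
    feasibleSet X A c ∩ univ.pi fun i => Metric.closedBall (x₀ i) (√(4 * C / μ i))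
  have hK : IsCompact K :=
    (isCompact_univ_pi fun i => isCompact_closedBall _ _).inter_left (isClosed_feasibleSet hX)
  have hx₀K : x₀ ∈ K := ⟨hx₀, fun i _ => Metric.mem_closedBall_self (Real.sqrt_nonneg _)⟩
  have hcont : ContinuousOn (fun y : Stacked d => ∑ i, f i (y i)) K := fun y hy =>
    (tendsto_finsetSum _ fun i _ => (ContinuousAt.comp (f := fun y : Stacked d => y i)
      (hd i _ (hmem hy.1 i)).continuousAt (continuous_apply i).continuousAt).continuousWithinAt)
  obtain ⟨x, hx, hmin⟩ := hK.exists_isMinOn ⟨x₀, hx₀K⟩ hcont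
  refine ⟨x, hx.1, fun y hy => ?_⟩
  change ∑ i, f i (x i) ≤ ∑ i, f i (y i)
  by_cases hyK : y ∈ K
  · exact hmin hyK
  refine le_trans (hmin hx₀K) ?_
  by_contra! hlt
  refine hyK ⟨hy, fun j _ => ?_⟩
  have h1 : ∑ i, (f i (x₀ i) + (μ i / 4 * ‖y i - x₀ i‖ ^ 2 - γ i ^ 2 / μ i)) ≤ ∑ i, f i (y i) :=
    Finset.sum_le_sum fun i _ => hgrow i _ (hmem hy i)
  rw [Finset.sum_add_distrib, Finset.sum_sub_distrib] at h1
  have h2 : μ j / 4 * ‖y j - x₀ j‖ ^ 2 ≤ ∑ i, μ i / 4 * ‖y i - x₀ i‖ ^ 2 :=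
    Finset.single_le_sum (f := fun i => μ i / 4 * ‖y i - x₀ i‖ ^ 2)
      (fun i _ => by have := hμ i; positivity) (Finset.mem_univ j)
  rw [mem_closedBall_iff_norm]
  refine Real.le_sqrt_of_sq_le ?_
  rw [le_div_iff₀ (hμ j)]
  have hC : C = ∑ i, γ i ^ 2 / μ i := rfl
  linarith

theorem IsOptimalSolution.sum_inner_gradient_nonneg (hXc : ∀ i, Convex ℝ (X i))
    (hd : ∀ i, ∀ x ∈ X i, DifferentiableAt ℝ (f i) x) {x y : Stacked d}
    (hx : IsOptimalSolution f X A c x) (hy : y ∈ feasibleSet X A c) :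
    0 ≤ ∑ i, inner ℝ (gradient (f i) (x i)) (y i - x i) := by
  have hder : HasFDerivAt (fun y : Stacked d => ∑ i, f i (y i))
      (∑ i, (innerSL ℝ (gradient (f i) (x i))) ∘L ContinuousLinearMap.proj i) x := by
    refine HasFDerivAt.fun_sum fun i _ => ?_
    exact HasFDerivAt.comp (f := fun y : Stacked d => y i) x
      (hd i _ (hx.1.2 i (mem_univ i))).hasGradientAt.hasFDerivAt
      (ContinuousLinearMap.proj (R := ℝ) (φ := fun i => EuclideanSpace ℝ (Fin (d i))) i).hasFDerivAt
  have := hx.2.localize.hasFDerivWithinAt_nonneg hder.hasFDerivWithinAt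
    (sub_mem_posTangentConeAt_of_segment_subset
      ((convex_feasibleSet hXc).segment_subset hx.1 hy))
  simpa using this

/-- The first-order condition at `x` and strong convexity make the value at `y` exceed that at `x`
by at least `∑ μ i / 2 * ‖y i - x i‖ ^ 2`. -/
theorem IsOptimalSolution.unique (hXc : ∀ i, Convex ℝ (X i))
    (hd : ∀ i, ∀ x ∈ X i, DifferentiableAt ℝ (f i) x) (hμ : ∀ i, 0 < μ i)
    (hf : ∀ i, StrongConvexOn (X i) (μ i) (f i)) {x y : Stacked d}
    (hx : IsOptimalSolution f X A c x) (hy : IsOptimalSolution f X A c y) : y = x := by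
  have h1 := hx.sum_inner_gradient_nonneg hXc hd hy.1
  have h2 : ∑ i, f i (y i) ≤ ∑ i, f i (x i) := hy.2 hx.1
  have h3 := Finset.sum_le_sum fun i (_ : i ∈ Finset.univ) =>
    (hf i).add_inner_gradient_le (hx.1.2 i (mem_univ i)) (hy.1.2 i (mem_univ i))
      (hd i _ (hx.1.2 i (mem_univ i)))
  simp only [Finset.sum_add_distrib] at h3
  have hnn : ∀ i ∈ Finset.univ, 0 ≤ μ i / 2 * ‖y i - x i‖ ^ 2 := fun i _ => by
    have := hμ i
    positivity
  have h4 : ∑ i, μ i / 2 * ‖y i - x i‖ ^ 2 = 0 :=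
    le_antisymm (by linarith) (Finset.sum_nonneg hnn)
  funext i
  have h5 := (Finset.sum_eq_zero_iff_of_nonneg hnn).1 h4 i (Finset.mem_univ i)
  have h6 := hμ i
  have h7 : ‖y i - x i‖ ^ 2 = 0 := (mul_eq_zero.1 h5).resolve_left (by positivity)
  exact sub_eq_zero.1 (norm_eq_zero.1 (pow_eq_zero_iff two_ne_zero |>.1 h7))

/-- A multiplier for the coupled constraint. -/
theorem IsOptimalSolution.exists_multiplier (hXc : ∀ i, Convex ℝ (X i))
    (hd : ∀ i, ∀ x ∈ X i, DifferentiableAt ℝ (f i) x)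
    (hslater : ∃ x ∈ intrinsicInterior ℝ (univ.pi X),
      ∑ i, Matrix.toEuclideanLin (A i) (x i) = c) {x : Stacked d}
    (hx : IsOptimalSolution f X A c x) :
    ∃ l : EuclideanSpace ℝ (Fin p), ∀ y ∈ univ.pi X,
      0 ≤ ∑ i, inner ℝ (gradient (f i) (x i) + Matrix.toEuclideanLin (A i).transpose l)
        (y i - x i) := by
  obtain ⟨x₀, hx₀, hx₀c⟩ := hslater
  let g : Stacked d →ₗ[ℝ] ℝ :=
    ∑ i, (innerSL ℝ (gradient (f i) (x i))).toLinearMap ∘ₗ LinearMap.proj i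
  have hg : ∀ v : Stacked d, g v = ∑ i, inner ℝ (gradient (f i) (x i)) (v i) := fun v => by
    simp [g]
  have hxc : coupling A x = c := by rw [coupling_apply]; exact hx.1.1
  obtain ⟨ℓ, hℓ⟩ := exists_multiplier_of_mem_intrinsicInterior (convex_pi fun i _ => hXc i) g
    (coupling A) hx.1.2 hx₀ (by rw [hxc, coupling_apply, hx₀c])
    (fun y hy hT => by
      rw [hg]
      exact hx.sum_inner_gradient_nonneg hXc hd
        ⟨by rw [← coupling_apply, hT, hxc], hy⟩)
  refine ⟨(InnerProductSpace.toDual ℝ _).symm (LinearMap.toContinuousLinearMap ℓ), fun y hy => ?_⟩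
  refine (hℓ y hy).trans_eq ?_
  rw [hg, coupling_apply, map_sum, ← Finset.sum_add_distrib]
  refine Finset.sum_congr rfl fun i _ => ?_
  rw [inner_add_left, real_inner_comm _ (Matrix.toEuclideanLin (A i).transpose _),
    ← inner_toEuclideanLin_left,
    real_inner_comm ((InnerProductSpace.toDual ℝ _).symm _), InnerProductSpace.toDual_symm_apply]
  rfl

end Optimum

/-! ### Passing from blocks to Euclidean products. -/

section PiLpHelpers

variable {ι : Type*} [Fintype ι] {V W : ι → Type*} [∀ i, NormedAddCommGroup (V i)]
  [∀ i, InnerProductSpace ℝ (V i)]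
  [∀ i, NormedAddCommGroup (W i)] [∀ i, InnerProductSpace ℝ (W i)]

theorem hasDerivWithinAt_piLp_two {u : ℝ → PiLp 2 V} {u' : PiLp 2 V} {s : Set ℝ} {t : ℝ} :
    HasDerivWithinAt u u' s t ↔ ∀ i, HasDerivWithinAt (fun r => u r i) (u' i) s t := by
  constructor
  · intro h i
    exact (PiLp.proj (𝕜 := ℝ) 2 V i).hasFDerivAt.comp_hasDerivWithinAt t h
  · intro h
    exact (PiLp.continuousLinearEquiv 2 ℝ V).symm.toContinuousLinearMap.hasFDerivAt
      |>.comp_hasDerivWithinAt t (hasDerivWithinAt_pi.2 h)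

/-- The block-diagonal map with blocks `T i`. -/
def PiLp.mapCLM [∀ i, FiniteDimensional ℝ (V i)] (T : ∀ i, V i →ₗ[ℝ] W i) :
    PiLp 2 V →L[ℝ] PiLp 2 W :=
  LinearMap.toContinuousLinearMap
    { toFun := fun x => WithLp.toLp 2 fun i => T i (x i)
      map_add' := fun x y => by ext i; simp
      map_smul' := fun c x => by ext i; simp }

theorem isProjectionMap_piLp {X : ∀ i, Set (V i)} {Q : ∀ i, V i → V i}
    (hQ : ∀ i, IsProjectionMap (X i) (Q i)) :
    IsProjectionMap {x : PiLp 2 V | ∀ i, x i ∈ X i} fun w => WithLp.toLp 2 fun i => Q i (w i) :=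
  fun w => ⟨fun i => (hQ i (w i)).1, fun u hu => by
    rw [PiLp.inner_apply]
    exact Finset.sum_nonpos fun i _ => (hQ i (w i)).2 _ (hu i)⟩

theorem locallyLipschitzOn_piLp {X : ∀ i, Set (V i)} {g : ∀ i, V i → V i}
    (hg : ∀ i, LocallyLipschitzOn (X i) (g i)) :
    LocallyLipschitzOn {x : PiLp 2 V | ∀ i, x i ∈ X i}
      fun x => WithLp.toLp 2 fun i => g i (x i) := by
  intro x hx
  choose K t ht hK using fun i => hg i (hx i)
  have hpi : LipschitzOnWith (∑ i, K i) (fun (y : PiLp 2 V) i => g i (y i))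
      (⋂ i, (fun y : PiLp 2 V => y i) ⁻¹' t i) := by
    refine LipschitzOnWith.of_dist_le_mul fun y hy z hz => ?_
    refine (dist_pi_le_iff (by positivity)).2 fun i => ?_
    have h1 := (hK i).dist_le_mul _ (mem_iInter.1 hy i) _ (mem_iInter.1 hz i)
    have h2 : dist (y i) (z i) ≤ dist y z := by
      rw [dist_eq_norm, dist_eq_norm]
      exact PiLp.norm_apply_le (y - z) i
    refine h1.trans (mul_le_mul ?_ h2 dist_nonneg (by positivity))
    exact_mod_cast Finset.single_le_sum (f := K) (fun _ _ => zero_le) (Finset.mem_univ i)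
  refine ⟨_, ⋂ i, (fun y : PiLp 2 V => y i) ⁻¹' t i, ?_,
    (PiLp.lipschitzWith_toLp 2 V).comp_lipschitzOnWith hpi⟩
  refine iInter_mem.2 fun i => ?_
  have hc : Tendsto (fun y : PiLp 2 V => y i) (𝓝[{x | ∀ i, x i ∈ X i}] x) (𝓝[X i] (x i)) :=
    ((PiLp.proj (𝕜 := ℝ) 2 V i).continuous.continuousWithinAt).tendsto_nhdsWithin
      fun y hy => hy i
  exact hc (ht i)

end PiLpHelpers

/-! ### The network dynamics as an instance of the abstract flow. -/

section Network

variable {n p : ℕ} {d : Fin n → ℕ}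

/-- `l ↦ (∑_j a_ij (l_i - l_j))_i`. -/
def WeightedDigraph.laplacianMap (G : WeightedDigraph n) (M : Type*) [AddCommGroup M]
    [Module ℝ M] : (Fin n → M) →ₗ[ℝ] Fin n → M where
  toFun l i := ∑ j, G.weight i j • (l i - l j)
  map_add' x y := by
    funext i
    simp only [Pi.add_apply, ← Finset.sum_add_distrib]
    refine Finset.sum_congr rfl fun j _ => ?_
    rw [← smul_add, add_sub_add_comm]
  map_smul' c x := by
    funext i
    simp only [Pi.smul_apply, RingHom.id_apply, Finset.smul_sum]
    refine Finset.sum_congr rfl fun j _ => ?_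
    rw [← smul_sub, smul_comm]

/-- `WeightedDigraph.laplacianMap` on the Euclidean product. -/
def WeightedDigraph.laplacianCLM (G : WeightedDigraph n) (V : Type*) [NormedAddCommGroup V]
    [InnerProductSpace ℝ V] [FiniteDimensional ℝ V] :
    (PiLp 2 fun _ : Fin n => V) →L[ℝ] PiLp 2 fun _ : Fin n => V :=
  LinearMap.toContinuousLinearMap
    { toFun := fun l => WithLp.toLp 2 (G.laplacianMap V l.ofLp)
      map_add' := fun x y => congrArg (WithLp.toLp 2) ((G.laplacianMap V).map_add x.ofLp y.ofLp)
      map_smul' := fun c x => congrArg (WithLp.toLp 2) ((G.laplacianMap V).map_smul c x.ofLp) }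

theorem WeightedDigraph.laplacianCLM_apply (G : WeightedDigraph n) {V : Type*}
    [NormedAddCommGroup V] [InnerProductSpace ℝ V] [FiniteDimensional ℝ V]
    (l : PiLp 2 fun _ : Fin n => V) (i : Fin n) :
    G.laplacianCLM V l i = ∑ j, G.weight i j • (l i - l j) := rfl

/-- The sum of the components. -/
def componentSum (n p : ℕ) : (PiLp 2 fun _ : Fin n => EuclideanSpace ℝ (Fin p)) →L[ℝ]
    EuclideanSpace ℝ (Fin p) :=
  ∑ i, PiLp.proj (𝕜 := ℝ) 2 (fun _ : Fin n => EuclideanSpace ℝ (Fin p)) i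

theorem componentSum_apply (l : PiLp 2 fun _ : Fin n => EuclideanSpace ℝ (Fin p)) :
    componentSum n p l = ∑ i, l i := by
  simp [componentSum]

/-- The witness `q` is `l` minus its mean over the agents: the mean is orthogonal to zero-sum
vectors. The inequality is the scalar one, applied to each of the `p` coordinates. -/
theorem WeightedDigraph.laplacianCLM_gap {G : WeightedDigraph n} (hn : 2 ≤ n)
    (hconn : G.StronglyConnected) (hbal : G.WeightBalanced)
    (l : PiLp 2 fun _ : Fin n => EuclideanSpace ℝ (Fin p)) :
    ∃ q : PiLp 2 fun _ : Fin n => EuclideanSpace ℝ (Fin p),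
      (∀ z, componentSum n p z = 0 → inner ℝ l z = inner ℝ q z) ∧
      secondSmallestEigenvalue hn G.symmLaplacian_isHermitian * ‖q‖ ^ 2
        ≤ inner ℝ l (G.laplacianCLM (EuclideanSpace ℝ (Fin p)) l) := by
  refine ⟨WithLp.toLp 2 fun i => l i - (n : ℝ)⁻¹ • ∑ j, l j, fun z hz => ?_, ?_⟩
  · rw [componentSum_apply] at hz
    simp only [PiLp.inner_apply (𝕜 := ℝ) (f := fun _ : Fin n => EuclideanSpace ℝ (Fin p)),
      inner_sub_left, Finset.sum_sub_distrib]
    rw [← inner_sum, hz, inner_zero_right, sub_zero]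
  · rw [PiLp.norm_sq_eq_of_L2]
    rw [PiLp.inner_apply]
    simp only [EuclideanSpace.real_norm_sq_eq, PiLp.inner_apply, WeightedDigraph.laplacianCLM_apply]
    rw [Finset.sum_comm, Finset.sum_comm (γ := Fin n), Finset.mul_sum]
    refine Finset.sum_le_sum fun k _ => ?_
    refine (G.spectral_gap_sub_mean hn hconn hbal fun i => l i k).trans_eq' ?_ |>.trans_eq ?_
    · simp
    · refine Finset.sum_congr rfl fun i _ => ?_
      simp [mul_comm]

/-- The flow Proj-IDEA in stacked form. -/
def projIDEAFlow (G : WeightedDigraph n) (f : ∀ i, EuclideanSpace ℝ (Fin (d i)) → ℝ)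
    (X : ∀ i, Set (EuclideanSpace ℝ (Fin (d i))))
    (Q : ∀ i, EuclideanSpace ℝ (Fin (d i)) → EuclideanSpace ℝ (Fin (d i)))
    (A : ∀ i, Matrix (Fin p) (Fin (d i)) ℝ) (b : Fin n → EuclideanSpace ℝ (Fin p)) (α β : ℝ) :
    ProjFlow (PiLp 2 fun i => EuclideanSpace ℝ (Fin (d i)))
      (PiLp 2 fun _ : Fin n => EuclideanSpace ℝ (Fin p)) where
  X := {x | ∀ i, x i ∈ X i}
  P := fun w => WithLp.toLp 2 fun i => Q i (w i)
  g := fun x => WithLp.toLp 2 fun i => gradient (f i) (x i)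
  A := PiLp.mapCLM fun i => Matrix.toEuclideanLin (A i)
  B := PiLp.mapCLM fun i => Matrix.toEuclideanLin (A i).transpose
  L := G.laplacianCLM (EuclideanSpace ℝ (Fin p))
  b := WithLp.toLp 2 b
  α := α
  β := β

variable {G : WeightedDigraph n} {f : ∀ i, EuclideanSpace ℝ (Fin (d i)) → ℝ}
  {X : ∀ i, Set (EuclideanSpace ℝ (Fin (d i)))}
  {Q : ∀ i, EuclideanSpace ℝ (Fin (d i)) → EuclideanSpace ℝ (Fin (d i))}
  {A : ∀ i, Matrix (Fin p) (Fin (d i)) ℝ} {b : Fin n → EuclideanSpace ℝ (Fin p)} {α β : ℝ}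

theorem isSolutionOn_projIDEAFlow_iff {w : ℝ → Stacked d}
    {l z : ℝ → Fin n → EuclideanSpace ℝ (Fin p)} {x : ℝ → Stacked d}
    (hx : ∀ t, 0 ≤ t → ∀ i, Q i (w t i) = x t i)
    (hproj : ∀ t, 0 ≤ t → ∀ i, IsProjection (X i) (w t i) (x t i)) :
    (projIDEAFlow G f X Q A b α β).IsSolutionOn (Ici 0) (fun t => WithLp.toLp 2 (w t))
      (fun t => WithLp.toLp 2 (l t)) (fun t => WithLp.toLp 2 (z t)) ↔
    IsProjIDEATrajectory G f X A b α β w l z x := by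
  constructor
  · intro h
    refine ⟨hproj, fun t ht i => ?_, fun t ht i => ?_, fun t ht i => ?_⟩
    · rw [← hx t ht]
      exact hasDerivWithinAt_piLp_two.1 (h.deriv_w t ht) i
    · rw [← hx t ht]
      exact hasDerivWithinAt_piLp_two.1 (h.deriv_l t ht) i
    · exact hasDerivWithinAt_piLp_two.1 (h.deriv_z t ht) i
  · intro h
    refine ⟨fun t ht => ?_, fun t ht => ?_, fun t ht => ?_⟩ <;>
      refine hasDerivWithinAt_piLp_two.2 fun i => ?_
    · have := h.deriv_w t ht i
      rw [← hx t ht] at this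
      exact this
    · have := h.deriv_l t ht i
      rw [← hx t ht] at this
      exact this
    · exact h.deriv_z t ht i

theorem admissible_projIDEAFlow (hn : 2 ≤ n) (hconn : G.StronglyConnected)
    (hbal : G.WeightBalanced) (hX : ∀ i, IsClosed (X i)) (hQ : ∀ i, IsProjectionMap (X i) (Q i))
    (hd : ∀ i, ∀ x ∈ X i, DifferentiableAt ℝ (f i) x)
    (hlip : ∀ i, LocallyLipschitzOn (X i) (gradient (f i)))
    {μ : Fin n → ℝ} (hμ : ∀ i, 0 < μ i) (hf : ∀ i, StrongConvexOn (X i) (μ i) (f i))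
    {φ : ℝ} (hφ : 0 < φ) (hα0 : 0 < α)
    (hα : (φ ^ 2 + 3 * φ + 3) * largestSingularValue (Matrix.blockDiagonal' A) ^ 2
      / ((φ + 1) * ⨅ i, μ i) ≤ α)
    (hβ : (φ + 1) ^ 2 * α
      / (φ * secondSmallestEigenvalue hn G.symmLaplacian_isHermitian) ≤ β) :
    (projIDEAFlow G f X Q A b α β).Admissible (componentSum n p) (⨅ i, μ i)
      (largestSingularValue (Matrix.blockDiagonal' A))
      (secondSmallestEigenvalue hn G.symmLaplacian_isHermitian) φ := by
  have : Nonempty (Fin n) := ⟨⟨0, by omega⟩⟩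
  have hμ0 : 0 < ⨅ i, μ i := by
    obtain ⟨i, hi⟩ := exists_eq_ciInf_of_finite (f := μ)
    rw [← hi]
    exact hμ i
  have hη := (G.spectral_gap hn hconn hbal).1
  exact
    { isClosed := by
        have h : (projIDEAFlow G f X Q A b α β).X = ⋂ i, PiLp.proj (𝕜 := ℝ) 2
            (fun i => EuclideanSpace ℝ (Fin (d i))) i ⁻¹' X i := by
          ext x
          simp [projIDEAFlow]
        rw [h]
        exact isClosed_iInter fun i => (hX i).preimage
          (PiLp.proj (𝕜 := ℝ) 2 (fun i => EuclideanSpace ℝ (Fin (d i))) i).continuous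
      isProjectionMap := isProjectionMap_piLp hQ
      locallyLipschitzOn := locallyLipschitzOn_piLp hlip
      monotone := fun x hx y hy => by
        rw [PiLp.norm_sq_eq_of_L2, PiLp.inner_apply, Finset.mul_sum]
        refine Finset.sum_le_sum fun i _ => ?_
        refine le_trans ?_ ((hf i).mul_norm_sub_sq_le_inner_gradient (hx i) (hy i)
          (hd i _ (hx i)) (hd i _ (hy i)))
        exact mul_le_mul_of_nonneg_right (ciInf_le (Finite.bddBelow_range μ) i) (sq_nonneg _)
      adjoint := fun x y => by
        rw [PiLp.inner_apply, PiLp.inner_apply]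
        exact Finset.sum_congr rfl fun i _ => inner_toEuclideanLin_left _ _ _
      norm_le := fun x => by
        refine le_of_sq_le_sq ?_ (mul_nonneg (LinearMap.singularValues_nonneg _ _)
          (norm_nonneg _))
        rw [mul_pow, PiLp.norm_sq_eq_of_L2, PiLp.norm_sq_eq_of_L2]
        exact sum_norm_sq_le_largestSingularValue A fun i => x i
      map_L := fun l => by
        rw [componentSum_apply]
        exact hbal.sum_laplacian_smul fun i => l i
      gap := WeightedDigraph.laplacianCLM_gap hn hconn hbal
      φ_pos := hφ
      α_pos := hα0
      μ_pos := hμ0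
      η_pos := hη
      le_α := (div_le_iff₀ (by positivity)).1 hα
      le_β := (div_le_iff₀ (by positivity)).1 hβ }

end Network

end

/-! ### The main theorem. -/

theorem theorem6 {n p : ℕ} (hn : 2 ≤ n) (d : Fin n → ℕ)
    (G : WeightedDigraph n) (hconn : G.StronglyConnected) (hbal : G.WeightBalanced)
    (f : ∀ i, EuclideanSpace ℝ (Fin (d i)) → ℝ)
    (X : ∀ i, Set (EuclideanSpace ℝ (Fin (d i))))
    (A : ∀ i, Matrix (Fin p) (Fin (d i)) ℝ)
    (b : Fin n → EuclideanSpace ℝ (Fin p))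
    (hXclosed : ∀ i, IsClosed (X i)) (hXconvex : ∀ i, Convex ℝ (X i))
    (hdiff : ∀ i, ∃ U : Set (EuclideanSpace ℝ (Fin (d i))), IsOpen U ∧ X i ⊆ U ∧
      DifferentiableOn ℝ (f i) U)
    (hlip : ∀ i, ∃ U : Set (EuclideanSpace ℝ (Fin (d i))), IsOpen U ∧ X i ⊆ U ∧
      LocallyLipschitzOn U (gradient (f i)))
    (hslater : ∃ x ∈ intrinsicInterior ℝ (Set.univ.pi X),
      ∑ i, Matrix.toEuclideanLin (A i) (x i) = ∑ i, b i)
    (μ : Fin n → ℝ) (hμ : ∀ i, 0 < μ i) (hf : ∀ i, StrongConvexOn (X i) (μ i) (f i))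
    (φ α β : ℝ) (hφ : 0 < φ) (hα0 : 0 < α)
    (hα : (φ ^ 2 + 3 * φ + 3) * largestSingularValue (Matrix.blockDiagonal' A) ^ 2
      / ((φ + 1) * ⨅ i, μ i) ≤ α)
    (hβ : (φ + 1) ^ 2 * α
      / (φ * secondSmallestEigenvalue hn G.symmLaplacian_isHermitian) ≤ β) :
    ∃ xs : Stacked d,
      IsOptimalSolution f X A (∑ i, b i) xs ∧
      (∀ y, IsOptimalSolution f X A (∑ i, b i) y → y = xs) ∧
      ∀ (w₀ : Stacked d) (l₀ z₀ : Fin n → EuclideanSpace ℝ (Fin p)), ∑ i, z₀ i = 0 →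
        (∃ (w : ℝ → Stacked d) (l z : ℝ → Fin n → EuclideanSpace ℝ (Fin p)) (x : ℝ → Stacked d),
          IsProjIDEATrajectory G f X A b α β w l z x ∧ w 0 = w₀ ∧ l 0 = l₀ ∧ z 0 = z₀) ∧
        ∀ (w : ℝ → Stacked d) (l z : ℝ → Fin n → EuclideanSpace ℝ (Fin p)) (x : ℝ → Stacked d),
          IsProjIDEATrajectory G f X A b α β w l z x → w 0 = w₀ → l 0 = l₀ → z 0 = z₀ →
          Filter.Tendsto x Filter.atTop (nhds xs) := by
  have hd : ∀ i, ∀ x ∈ X i, DifferentiableAt ℝ (f i) x := fun i x hx =>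
    let ⟨U, hU, hXU, hdU⟩ := hdiff i
    hdU.differentiableAt (hU.mem_nhds (hXU hx))
  have hlipX : ∀ i, LocallyLipschitzOn (X i) (gradient (f i)) := fun i =>
    let ⟨U, _, hXU, hlU⟩ := hlip i
    hlU.mono hXU
  obtain ⟨x₀, hx₀, hx₀b⟩ := id hslater
  have hx₀X := intrinsicInterior_subset hx₀
  obtain ⟨xs, hxs⟩ := exists_isOptimalSolution (f := f) (A := A) (c := ∑ i, b i) hXclosed hd hμ hf
    ⟨x₀, hx₀b, hx₀X⟩
  refine ⟨xs, hxs, fun y hy => hxs.unique hXconvex hd hμ hf hy, fun w₀ l₀ z₀ hz₀ => ?_⟩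
  choose Q hQ using fun i => exists_isProjectionMap ⟨x₀ i, hx₀X i (mem_univ i)⟩ (hXclosed i)
    (hXconvex i)
  obtain ⟨ls, hls⟩ := hxs.exists_multiplier hXconvex hd hslater
  have hD := admissible_projIDEAFlow (b := b) hn hconn hbal hXclosed hQ hd hlipX hμ hf hφ hα0 hα hβ
  -- Every agent holds the same multiplier `ls`, so the Laplacian annihilates it; feasibility says
  -- that the local residuals `A_i x_i - b_i` sum to zero.
  have he : (projIDEAFlow G f X Q A b α β).IsEquilibrium (componentSum n p) (WithLp.toLp 2 xs)
      (WithLp.toLp 2 fun _ => ls) :=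
    { mem := fun i => hxs.1.2 i (mem_univ i)
      map_l := by
        ext i : 1
        change ∑ j, G.weight i j • (ls - ls) = 0
        simp
      map_residual := by
        rw [componentSum_apply]
        refine (Finset.sum_sub_distrib (fun i => Matrix.toEuclideanLin (A i) (xs i)) b).trans ?_
        rw [hxs.1.1, sub_self]
      variational := fun y hy => by
        rw [PiLp.inner_apply]
        exact hls (fun i => y i) fun i _ => hy i }
  have hz₀' : componentSum n p (WithLp.toLp 2 z₀) = 0 := by
    rw [componentSum_apply]
    exact hz₀
  constructor
  · obtain ⟨w, l, z, hsol, hw, hl, hz⟩ := hD.exists_isSolutionOn he (WithLp.toLp 2 w₀)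
      (WithLp.toLp 2 l₀) (WithLp.toLp 2 z₀) hz₀'
    refine ⟨fun t => (w t).ofLp, fun t => (l t).ofLp, fun t => (z t).ofLp,
      fun t i => Q i (w t i), (isSolutionOn_projIDEAFlow_iff (fun _ _ _ => rfl)
        fun t _ i => (isProjection_iff_inner_le_zero (hXconvex i)).2 (hQ i _)).1 hsol, ?_, ?_, ?_⟩
    · simp [hw]
    · simp [hl]
    · simp [hz]
  · intro w l z x h hw hl hz
    -- Uniqueness of the projection identifies the given `x` with `Q i (w t i)` for `t ≥ 0`; earlier
    -- times do not affect the limit.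
    have hx : ∀ t, 0 ≤ t → ∀ i, Q i (w t i) = x t i := fun t ht i =>
      have := (isProjection_iff_inner_le_zero (hXconvex i)).1 (h.proj t ht i)
      (hQ i).eq_of_inner_le_zero this.1 this.2
    have hlim := hD.tendsto he ((isSolutionOn_projIDEAFlow_iff hx h.proj).2 h) (by
      rw [hz]
      exact hz₀')
    have hlim' := ((PiLp.continuous_ofLp 2 _).tendsto _).comp hlim
    refine hlim'.congr' ?_
    filter_upwards [eventually_ge_atTop 0] with t ht
    exact funext fun i => hx t ht i
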